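/- Let $n\ge 0$. Let $A_n$ act on $\mathbb{R}^{m}$, $m=n+1$, by permutations of the coordinates, and let $B_n$ act on $\mathbb{R}^{m}$, $m=n$, by signed permutations of the coordinates. Let $\mathcal{W}$ be one of these two groups. Its reflection arrangement $\mathcal{A}$ is the finite set of all hyperplanes $H\subset\mathbb{R}^m$ such that the orthogonal reflection in $H$ belongs to $\mathcal{W}$. Let $L(\mathcal{A})$ be the lattice of all intersections of subsets of $\mathcal{A}$ (including $\mathbb{R}^m$, the empty intersection), ordered by reverse inclusion, let $\mu$ be its Möbius function, determined by $\mu(\mathbb{R}^m)=1$ and $\sum_{Z\le Y}\mu(Z)=0$ for $Y\neq\mathbb{R}^m$, and let $$\chi_{\mathcal{W}}(t)=\sum_{X\in L(\mathcal{A})}\mu(X)\,t^{\dim X}$$ be the characteristic polynomial. A fundamental chamber of $\mathcal{W}$ is the closure of a connected component of $\mathbb{R}^m\setminus\bigcup_{H\in\mathcal{A}}H$. For a fundamental chamber $\mathcal{C}$, a weight vector $\omega\in(0,\infty)^m$ and $y\in\mathbb{R}^m$ put $$\pi_{\mathcal{C}}(y;\omega)=\operatorname*{arg\,min}_{z\in\mathcal{C}}\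 \sum_{i=1}^m\omega_i(z_i-y_i)^2 ,$$ and call a point of $\mathcal{C}$ $k$-dimensional if it lies in the relative interior of a $k$-dimensional face of $\mathcal{C}$. For $g\in\mathcal{W}$ let $g\omega$ be the weight vector obtained by applying to $\omega$ the permutation of coordinates underlying $g$, without the signs, i.e. $(g\omega)_i=\omega_j$ if $(gx)_i=\pm x_j$ for all $x$. Then $$\chi_{A_n}(t)=\prod_{j=0}^{n}(t-j),\qquad \chi_{B_n}(t)=\prod_{j=1}^{n}\bigl(t-(2j-1)\bigr).$$ Moreover, for $\mathcal{W}=A_n$ or $\mathcal{W}=B_n$, every fundamental chamber $\mathcal{C}$ of $\mathcal{W}$ and every weight vector $\omega\in(0,\infty)^m$, the following holds for a generic point $x\in\mathcal{C}$, that is, for all $x\in\mathcal{C}$ outside the union of some finite collection (which may depend on $\mathcal{C}$ and $\omega$) of proper linear subspaces of $\mathbb{R}^m$: for every integer $k\ge 0$, the number of $g\in\mathcal{W}$ for which $\pi_{\mathcal{C}}(gx;g\omega)$ is $k$-dimensional equals the absolute value of the coefficient of $t^k$ in $\chi_{\mathcal{W}}(t)$. -/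

import Mathlib

open Polynomial

namespace ReflArr

/-! ### Hyperplane arrangements and the characteristic polynomial -/

section Arrangement

variable {V : Type*} [AddCommGroup V] [Module ℝ V]

open Classical in
/-- All intersections of subcollections of `A`; the empty subcollection gives the whole space. -/
noncomputable def intersections (A : Finset (Submodule ℝ V)) : Finset (Submodule ℝ V) :=
  A.powerset.image fun S => S.inf id

/-- The whole space is the intersection of the empty subcollection. -/
theorem top_mem_intersections (A : Finset (Submodule ℝ V)) : ⊤ ∈ intersections A := by
  classical
  exact Finset.mem_image.2 ⟨∅, by simp, by simp⟩

/-- The intersection lattice `L(A)`, ordered by reverse inclusion. -/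
abbrev IntersectionLattice (A : Finset (Submodule ℝ V)) : Type _ :=
  {X : Submodule ℝ V // X ∈ intersections A}ᵒᵈ

/-- The whole space, which is the least element of `L(A)`. -/
def ambient (A : Finset (Submodule ℝ V)) : IntersectionLattice A :=
  OrderDual.toDual ⟨⊤, top_mem_intersections A⟩

open Classical in
/-- The Möbius function `μ(X) = μ(V, X)` of the intersection lattice. -/
noncomputable def moebius (A : Finset (Submodule ℝ V)) (X : IntersectionLattice A) : ℤ :=
  letI : LocallyFiniteOrder (IntersectionLattice A) := Fintype.toLocallyFiniteOrder
  IncidenceAlgebra.mu ℤ (ambient A) X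

/-- The characteristic polynomial `χ_A(t) = ∑_{X ∈ L(A)} μ(X) t ^ dim X`. -/
noncomputable def charPoly (A : Finset (Submodule ℝ V)) : ℤ[X] :=
  ∑ X : IntersectionLattice A,
    C (moebius A X) * Polynomial.X ^ Module.finrank ℝ (OrderDual.ofDual X).1

end Arrangement

/-! ### Reflection arrangements, fundamental chambers, faces -/

section Reflection

variable {V : Type*} [NormedAddCommGroup V] [InnerProductSpace ℝ V] [FiniteDimensional ℝ V]

/-- The mirrors of a group `W` of isometries: the linear hyperplanes `H` such that the reflection
in `H` belongs to `W`. -/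
def mirrors (W : Subgroup (V ≃ₗᵢ[ℝ] V)) : Set (Submodule ℝ V) :=
  {H | Module.finrank ℝ H + 1 = Module.finrank ℝ V ∧ H.reflection ∈ W}

/-- A reflection determines its mirror. -/
theorem reflection_injective :
    Function.Injective fun H : Submodule ℝ V => (H.reflection : V ≃ₗᵢ[ℝ] V) := by
  intro H K h
  ext x
  have h' : H.reflection = K.reflection := h
  rw [← Submodule.reflection_eq_self_iff, h', Submodule.reflection_eq_self_iff]

/-- A finite group has finitely many mirrors. -/
theorem mirrors_finite (W : Subgroup (V ≃ₗᵢ[ℝ] V)) [Finite W] : (mirrors W).Finite :=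
  ((W : Set (V ≃ₗᵢ[ℝ] V)).toFinite.preimage reflection_injective.injOn).subset fun _ h => h.2

/-- The reflection arrangement of a finite group of isometries: the collection of its mirrors. -/
noncomputable def reflectionArrangement (W : Subgroup (V ≃ₗᵢ[ℝ] V)) [Finite W] :
    Finset (Submodule ℝ V) :=
  (mirrors_finite W).toFinset

/-- `K` is the closure of a region of the arrangement `A`, that is, of a connected component of the
complement of the union of the hyperplanes in `A`. -/
def IsChamber (A : Finset (Submodule ℝ V)) (K : Set V) : Prop :=
  ∃ x ∈ (⋃ H ∈ A, (H : Set V))ᶜ, K = closure (connectedComponentIn (⋃ H ∈ A, (H : Set V))ᶜ x)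

/-- The point `z` is `k`-dimensional with respect to the polyhedral cone `K`: it lies in the
relative interior of a `k`-dimensional face of `K`. (For a polyhedral cone, the nonempty faces are
the nonempty exposed faces, `K` itself being one of them.) -/
def IsKDimensional (K : Set V) (z : V) (k : ℕ) : Prop :=
  ∃ F : Set V, F ⊆ K ∧ IsExposed ℝ K F ∧ Module.finrank ℝ (vectorSpan ℝ F) = k ∧
    z ∈ intrinsicInterior ℝ F

/-- The property `P` holds for generic points of `K`: for all points of `K` that avoid a suitable
finite collection of proper linear subspaces. -/
def ForGeneric (K : Set V) (P : V → Prop) : Prop :=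
  ∃ N : Finset (Submodule ℝ V), (∀ H ∈ N, H ≠ ⊤) ∧ ∀ x ∈ K, (∀ H ∈ N, x ∉ H) → P x

end Reflection

/-! ### Weighted projections -/

/-- `z` is the weighted projection `π_K(y; ω)`: it minimizes `∑ ω_i (x_i - y_i)^2` over
`x ∈ K`. -/
def IsWeightedProjection {m : ℕ} (K : Set (EuclideanSpace ℝ (Fin m))) (y : EuclideanSpace ℝ (Fin m))
    (ω : Fin m → ℝ) (z : EuclideanSpace ℝ (Fin m)) : Prop :=
  z ∈ K ∧ IsMinOn (fun x : EuclideanSpace ℝ (Fin m) => ∑ i, ω i * (x i - y i) ^ 2) K z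

/-- The weight vector `gω`. A signed permutation `g` moves the weights along with the coordinates
of a vector, the signs being disregarded, so that weights remain positive: if
`(g x)_i = ± x_j` for all `x`, then `(g ω)_i = ω_j`. -/
noncomputable def weightAct {m : ℕ} (g : EuclideanSpace ℝ (Fin m) ≃ₗᵢ[ℝ] EuclideanSpace ℝ (Fin m))
    (ω : Fin m → ℝ) : Fin m → ℝ :=
  fun i => |g (WithLp.toLp 2 ω) i|

/-- The number of `g ∈ W` for which `π_K(g x; g ω)` is `k`-dimensional. -/
noncomputable def projectionCount {m : ℕ}
    (W : Subgroup (EuclideanSpace ℝ (Fin m) ≃ₗᵢ[ℝ] EuclideanSpace ℝ (Fin m)))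
    (K : Set (EuclideanSpace ℝ (Fin m))) (ω : Fin m → ℝ) (x : EuclideanSpace ℝ (Fin m)) (k : ℕ) :
    ℕ :=
  Set.ncard {g | g ∈ W ∧ ∃ z, IsWeightedProjection K (g x) (weightAct g ω) z ∧
    IsKDimensional K z k}

/-! ### The groups of type A and B -/

/-- The group `B_m` of signed permutations of the coordinates of `ℝ^m`. -/
def groupB (m : ℕ) : Subgroup (EuclideanSpace ℝ (Fin m) ≃ₗᵢ[ℝ] EuclideanSpace ℝ (Fin m)) where
  carrier := {g | ∃ (σ : Equiv.Perm (Fin m)) (s : Fin m → ℤˣ), ∀ x i, g x i = (s i : ℝ) * x (σ i)}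
  one_mem' := ⟨1, 1, by simp⟩
  mul_mem' := by
    rintro a b ⟨σ, s, ha⟩ ⟨τ, t, hb⟩
    refine ⟨τ * σ, fun i => s i * t (σ i), fun x i => ?_⟩
    simp [ha, hb, mul_assoc]
  inv_mem' := by
    rintro a ⟨σ, s, ha⟩
    refine ⟨σ⁻¹, fun i => s (σ⁻¹ i), fun x i => ?_⟩
    have h := ha (a⁻¹ x) (σ⁻¹ i)
    have h1 : a (a⁻¹ x) = x := a.apply_symm_apply x
    have h2 : σ (σ⁻¹ i) = i := σ.apply_symm_apply i
    rw [h1, h2] at h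
    rw [h, ← mul_assoc]
    have h3 : ((s (σ⁻¹ i) : ℤ) : ℝ) * ((s (σ⁻¹ i) : ℤ) : ℝ) = 1 := by
      rw [← Int.cast_mul, Int.units_coe_mul_self, Int.cast_one]
    rw [h3, one_mul]

/-- The group of all permutations of the coordinates of `ℝ^m`, which is of type `A_{m-1}`. -/
def permGroup (m : ℕ) : Subgroup (EuclideanSpace ℝ (Fin m) ≃ₗᵢ[ℝ] EuclideanSpace ℝ (Fin m)) where
  carrier := {g | ∃ σ : Equiv.Perm (Fin m), ∀ x i, g x i = x (σ i)}
  one_mem' := ⟨1, by simp⟩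
  mul_mem' := by
    rintro a b ⟨σ, ha⟩ ⟨τ, hb⟩
    exact ⟨τ * σ, fun x i => by simp [ha, hb]⟩
  inv_mem' := by
    rintro a ⟨σ, ha⟩
    refine ⟨σ⁻¹, fun x i => ?_⟩
    have h := ha (a⁻¹ x) (σ⁻¹ i)
    have h1 : a (a⁻¹ x) = x := a.apply_symm_apply x
    have h2 : σ (σ⁻¹ i) = i := σ.apply_symm_apply i
    rw [h1, h2] at h
    exact h.symm

/-- The group `A_n`, acting on `ℝ^(n+1)` by permutations of the coordinates. -/
abbrev groupA (n : ℕ) :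
    Subgroup (EuclideanSpace ℝ (Fin (n + 1)) ≃ₗᵢ[ℝ] EuclideanSpace ℝ (Fin (n + 1))) :=
  permGroup (n + 1)

instance finite_groupB (m : ℕ) : Finite (groupB m) := by
  choose σ s h using fun g : groupB m => g.2
  refine Finite.of_injective (fun g => (σ g, s g)) fun a b hab => ?_
  have h1 : σ a = σ b := congrArg Prod.fst hab
  have h2 : s a = s b := congrArg Prod.snd hab
  ext x i
  rw [h a, h b, h1, h2]

instance finite_permGroup (m : ℕ) : Finite (permGroup m) := by
  choose σ h using fun g : permGroup m => g.2
  refine Finite.of_injective σ fun a b hab => ?_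
  ext x i
  rw [h a, h b, hab]

end ReflArr

/-! Pull the minimization for `g` back along `g`. The weights become the fixed vector `ω`, the data
become `x` with some signs, and `g` survives only as an ordering of the letters together with those
signs (`isWeightedProjection_signedPerm_iff`). What remains is isotonic regression along a list,
with nonnegativity constraints in type B.

Isotonic regression is solved by pooling. Every list splits uniquely into blocks of strictly
increasing weighted means, a block being a list that no cut separates into parts of increasing mean.
The minimizer is the block mean on each block, truncated at zero in type B (`isotonic_iff`,
`nonneg_isotonic_iff`). Faces of the chamber are given by coincidences of coordinates, so the
dimension of the projection is the number of blocks in type A and the number of blocks of positive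
mean in type B.

It remains to count orderings by blocks. For generic values a cycle lemma says that exactly one
rotation of a list is a block, so a nonempty set `B` has `(|B| - 1)!` orderings that are blocks, as
many as it has cyclic orders. Since blocks sort themselves by mean, an ordering is the same as an
unordered collection of blocks. Orderings by blocks are therefore counted like permutations by
cycles, and removing the block of a chosen letter gives the recursion `blockSum_rec`. In type A it
yields `∑ t ^ blocks = t (t + 1) ⋯ (t + m - 1)`. In type B, flipping all signs in a block negates
its mean, so over all signs a block weighs `(t + 1) / 2` on average, and the sum is `2 ^ m ∏ ((t +
1) / 2 + i) = ∏ (t + 2 i + 1)`.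

The characteristic polynomials are found by counting integral points. Each intersection of mirrors
of dimension `d` contains `(2 s + 1) ^ d` points of the cube `[-s, s] ^ m`, so Möbius inversion
makes `χ (2 s + 1)` the number of points of the cube on no mirror (`eval_charPoly`). These are
injective functions in type A and functions with injective nonzero absolute value in type B.
Finally, passing from `∏ (t - a)` to `∏ (t + a)` with `a ≥ 0` only removes the signs of the
coefficients. -/

namespace ReflArr

/-! ### Decomposition of a list into blocks of increasing means -/

section Blocks

variable {ι : Type*}

/-- The weighted mean of `x` over the list `l`. -/
noncomputable def listMean (w x : ι → ℝ) (l : List ι) : ℝ :=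
  (l.map fun i => w i * x i).sum / (l.map w).sum

/-- A nonempty list is a block if no splitting of it has increasing means. -/
def IsBlock (w x : ι → ℝ) (b : List ι) : Prop :=
  b ≠ [] ∧ ∀ p q, p ≠ [] → q ≠ [] → b = p ++ q → listMean w x q ≤ listMean w x p

/-- A list of blocks with strictly increasing means. -/
def IsBlockList (w x : ι → ℝ) (bs : List (List ι)) : Prop :=
  (∀ b ∈ bs, IsBlock w x b) ∧ bs.Pairwise fun a b => listMean w x a < listMean w x b

variable {w x : ι → ℝ}

theorem sum_map_pos_of_ne_nil (hw : ∀ i, 0 < w i) {l : List ι} (hl : l ≠ []) :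
    0 < (l.map w).sum := by
  apply List.sum_pos
  · simp only [List.mem_map]
    rintro _ ⟨i, _, rfl⟩
    exact hw i
  · simpa using hl

theorem sum_map_mul_eq (hw : ∀ i, 0 < w i) {l : List ι} (hl : l ≠ []) :
    (l.map fun i => w i * x i).sum = listMean w x l * (l.map w).sum := by
  rw [listMean, div_mul_cancel₀ _ (sum_map_pos_of_ne_nil hw hl).ne']

/-- The mean of a concatenation is a convex combination of the two means; all comparisons of means
below come from this form without denominators. -/
theorem listMean_append_mul (hw : ∀ i, 0 < w i) {a b : List ι} (ha : a ≠ []) (hb : b ≠ []) :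
    listMean w x (a ++ b) * ((a.map w).sum + (b.map w).sum) =
      listMean w x a * (a.map w).sum + listMean w x b * (b.map w).sum := by
  rw [← sum_map_mul_eq hw ha, ← sum_map_mul_eq hw hb, ← List.sum_append, ← List.map_append,
    ← List.sum_append, ← List.map_append, sum_map_mul_eq hw (by simp [ha])]

theorem listMean_append_le (hw : ∀ i, 0 < w i) {a b : List ι} (ha : a ≠ []) (hb : b ≠ []) {M : ℝ}
    (h₁ : listMean w x a ≤ M) (h₂ : listMean w x b ≤ M) : listMean w x (a ++ b) ≤ M := by
  have h := listMean_append_mul (x := x) hw ha hb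
  have pa := sum_map_pos_of_ne_nil hw ha
  have pb := sum_map_pos_of_ne_nil hw hb
  refine le_of_mul_le_mul_right ?_ (add_pos pa pb)
  rw [h, mul_add]
  gcongr

theorem le_listMean_append (hw : ∀ i, 0 < w i) {a b : List ι} (ha : a ≠ []) (hb : b ≠ []) {M : ℝ}
    (h₁ : M ≤ listMean w x a) (h₂ : M ≤ listMean w x b) : M ≤ listMean w x (a ++ b) := by
  have h := listMean_append_mul (x := x) hw ha hb
  have pa := sum_map_pos_of_ne_nil hw ha
  have pb := sum_map_pos_of_ne_nil hw hb
  refine le_of_mul_le_mul_right ?_ (add_pos pa pb)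
  rw [h, mul_add]
  gcongr

theorem lt_listMean_append (hw : ∀ i, 0 < w i) {a b : List ι} (ha : a ≠ []) (hb : b ≠ []) {M : ℝ}
    (h₁ : M < listMean w x a) (h₂ : M < listMean w x b) : M < listMean w x (a ++ b) := by
  have h := listMean_append_mul (x := x) hw ha hb
  have pa := sum_map_pos_of_ne_nil hw ha
  have pb := sum_map_pos_of_ne_nil hw hb
  refine lt_of_mul_lt_mul_right ?_ (add_pos pa pb).le
  rw [h, mul_add]
  gcongr

theorem IsBlock.singleton (a : ι) : IsBlock w x [a] := by
  refine ⟨by simp, fun p q hp hq h => ?_⟩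
  have := congrArg List.length h
  have := List.length_pos_of_ne_nil hp
  have := List.length_pos_of_ne_nil hq
  simp only [List.length_append, List.length_singleton] at *
  omega

theorem IsBlock.listMean_le_prefix (hw : ∀ i, 0 < w i) {p q : List ι} (h : IsBlock w x (p ++ q))
    (hp : p ≠ []) : listMean w x (p ++ q) ≤ listMean w x p := by
  rcases eq_or_ne q [] with rfl | hq
  · simp
  · exact listMean_append_le hw hp hq le_rfl (h.2 p q hp hq rfl)

theorem IsBlock.suffix_le_listMean (hw : ∀ i, 0 < w i) {p q : List ι} (h : IsBlock w x (p ++ q))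
    (hq : q ≠ []) : listMean w x q ≤ listMean w x (p ++ q) := by
  rcases eq_or_ne p [] with rfl | hp
  · simp
  · exact le_listMean_append hw hp hq (h.2 p q hp hq rfl) le_rfl

/-- The pooling step: a cut of `a ++ b` falls inside `a` or inside `b`. Prefixes of a block lie
above its mean and suffixes below, so the order of the two means decides. -/
theorem IsBlock.append (hw : ∀ i, 0 < w i) {a b : List ι} (ha : IsBlock w x a)
    (hb : IsBlock w x b) (hab : listMean w x b ≤ listMean w x a) : IsBlock w x (a ++ b) := by
  refine ⟨by simp [ha.1], fun p q hp hq h => ?_⟩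
  rcases List.append_eq_append_iff.1 h with ⟨c, rfl, rfl⟩ | ⟨c, rfl, rfl⟩
  · have h1 := hb.suffix_le_listMean hw hq
    rcases eq_or_ne c [] with rfl | hc
    · simpa using hab
    · exact le_listMean_append hw ha.1 hc (h1.trans hab) (hb.2 c q hc hq rfl)
  · have h1 := ha.listMean_le_prefix hw hp
    rcases eq_or_ne c [] with rfl | hc
    · simpa using hab
    · exact listMean_append_le hw hc hb.1 (ha.2 p c hp hc rfl) (hab.trans h1)

/-- Pool adjacent violators: the new block absorbs its right neighbour until its mean is strictly
smaller than the next one. -/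
theorem exists_isBlockList_append (hw : ∀ i, 0 < w i) {bs : List (List ι)}
    (hbs : IsBlockList w x bs) {b : List ι} (hb : IsBlock w x b) :
    ∃ cs, IsBlockList w x cs ∧ cs.flatten = b ++ bs.flatten := by
  induction bs generalizing b with
  | nil => exact ⟨[b], ⟨by simpa using hb, by simp⟩, by simp⟩
  | cons c cs ih =>
    have hc := hbs.1 c (by simp)
    have hcs : IsBlockList w x cs := ⟨fun d hd => hbs.1 d (by simp [hd]), hbs.2.of_cons⟩
    rcases lt_or_ge (listMean w x b) (listMean w x c) with h | h
    · refine ⟨b :: c :: cs, ⟨?_, ?_⟩, by simp⟩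
      · intro d hd
        rcases List.mem_cons.1 hd with rfl | hd
        · exact hb
        · exact hbs.1 d hd
      · refine List.pairwise_cons.2 ⟨fun d hd => ?_, hbs.2⟩
        rcases List.mem_cons.1 hd with rfl | hd
        · exact h
        · exact h.trans ((List.pairwise_cons.1 hbs.2).1 d hd)
    · obtain ⟨ds, h1, h2⟩ := ih hcs (hb.append hw hc h)
      exact ⟨ds, h1, by simp [h2]⟩

theorem exists_isBlockList (hw : ∀ i, 0 < w i) (l : List ι) :
    ∃ bs, IsBlockList w x bs ∧ bs.flatten = l := by
  induction l with
  | nil => exact ⟨[], ⟨by simp, by simp⟩, rfl⟩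
  | cons a l ih =>
    obtain ⟨bs, h1, rfl⟩ := ih
    exact exists_isBlockList_append hw h1 (IsBlock.singleton a)

/-- Such a prefix consists of whole blocks of larger mean, possibly followed by a prefix of a block,
whose mean is at least that of the block. -/
theorem IsBlockList.listMean_lt_prefix (hw : ∀ i, 0 < w i) {b : List ι} {bs : List (List ι)}
    (h : IsBlockList w x (b :: bs)) {p q : List ι} (hp : p ≠ []) (hpq : bs.flatten = p ++ q) :
    listMean w x b < listMean w x p := by
  induction bs generalizing b p q with
  | nil =>
    simp only [List.flatten_nil] at hpq
    exact absurd (List.append_eq_nil_iff.1 hpq.symm).1 hp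
  | cons c cs ih =>
    have hc := h.1 c (by simp)
    have hbc := (List.pairwise_cons.1 h.2).1 c (by simp)
    have hcs : IsBlockList w x (c :: cs) := ⟨fun d hd => h.1 d (by simp_all), h.2.of_cons⟩
    rw [List.flatten_cons] at hpq
    rcases List.append_eq_append_iff.1 hpq with ⟨r, rfl, hr⟩ | ⟨r, rfl, rfl⟩
    · rcases eq_or_ne r [] with rfl | hr'
      · simpa using hbc
      · exact lt_listMean_append hw hc.1 hr' hbc (hbc.trans (ih hcs hr' hr))
    · exact hbc.trans_le (hc.listMean_le_prefix hw hp)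

theorem IsBlockList.eq_nil {bs : List (List ι)} (h : IsBlockList w x bs) (hf : bs.flatten = []) :
    bs = [] := by
  refine List.eq_nil_iff_forall_not_mem.2 fun b hb => (h.1 b hb).1 ?_
  exact List.flatten_eq_nil_iff.1 hf b hb

/-- If one first block properly extended the other, the extra part would begin the remainder of the
other list and have larger mean than its first block. This would be a forbidden cut of the longer
block. -/
theorem IsBlockList.flatten_injective (hw : ∀ i, 0 < w i) {bs cs : List (List ι)}
    (hb : IsBlockList w x bs) (hc : IsBlockList w x cs) (h : bs.flatten = cs.flatten) :
    bs = cs := by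
  induction bs generalizing cs with
  | nil => exact (hc.eq_nil h.symm).symm
  | cons b bs ih =>
    cases cs with
    | nil => exact hb.eq_nil h
    | cons c cs =>
      have hbs : IsBlockList w x bs := ⟨fun d hd => hb.1 d (by simp [hd]), hb.2.of_cons⟩
      have hcs : IsBlockList w x cs := ⟨fun d hd => hc.1 d (by simp [hd]), hc.2.of_cons⟩
      rw [List.flatten_cons, List.flatten_cons] at h
      have h' : b = c := by
        rcases List.append_eq_append_iff.1 h with ⟨r, h1, h2⟩ | ⟨r, h1, h2⟩ <;>
        rcases eq_or_ne r [] with rfl | hr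
        · simpa using h1.symm
        · have h3 := (hc.1 c (by simp)).2 b r (hb.1 b (by simp)).1 hr h1
          exact absurd h3 (hb.listMean_lt_prefix hw hr h2).not_ge
        · simpa using h1
        · have h3 := (hb.1 b (by simp)).2 c r (hc.1 c (by simp)).1 hr h1
          exact absurd h3 (hc.listMean_lt_prefix hw hr h2).not_ge
      subst h'
      rw [ih hbs hcs (List.append_cancel_left h)]

/-- The decomposition of a list into blocks of increasing means. -/
noncomputable def blocks (hw : ∀ i, 0 < w i) (x : ι → ℝ) (l : List ι) : List (List ι) :=
  (exists_isBlockList (x := x) hw l).choose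

theorem isBlockList_blocks (hw : ∀ i, 0 < w i) (l : List ι) : IsBlockList w x (blocks hw x l) :=
  (exists_isBlockList (x := x) hw l).choose_spec.1

theorem flatten_blocks (hw : ∀ i, 0 < w i) (l : List ι) : (blocks hw x l).flatten = l :=
  (exists_isBlockList (x := x) hw l).choose_spec.2

theorem IsBlockList.blocks_flatten (hw : ∀ i, 0 < w i) {bs : List (List ι)}
    (h : IsBlockList w x bs) : blocks hw x bs.flatten = bs :=
  (isBlockList_blocks hw _).flatten_injective hw h (flatten_blocks hw _)

end Blocks

/-! ### Rotations of blocks -/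

section Rotation

variable {ι : Type*} {w x : ι → ℝ}

/-- Disjoint nonempty sets of letters have different means. -/
def IsGenericValues (w x : ι → ℝ) : Prop :=
  ∀ p q : List ι, p ≠ [] → q ≠ [] → (p ++ q).Nodup → listMean w x p ≠ listMean w x q

/-- Cycle lemma: subtract the overall mean so that the total is zero, and start at a minimum of the
partial sums. All prefixes of the rotated list then have nonnegative sum, hence all suffixes
nonpositive sum. -/
theorem exists_isBlock_rotation (hw : ∀ i, 0 < w i) {l : List ι} (hl : l ≠ []) :
    ∃ a b, b ≠ [] ∧ l = a ++ b ∧ IsBlock w x (b ++ a) := by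
  classical
  set f : ι → ℝ := fun i => w i * (x i - listMean w x l) with hf
  have hsum : ∀ k : List ι, (k.map f).sum =
      (k.map fun i => w i * x i).sum - listMean w x l * (k.map w).sum := by
    intro k
    induction k with
    | nil => simp
    | cons a k ih =>
      simp only [List.map_cons, List.sum_cons, ih]
      simp only [hf]
      ring
  have hl0 : (l.map f).sum = 0 := by
    rw [hsum, sum_map_mul_eq hw hl, sub_self]
  obtain ⟨a, b, hb, hab, hmin⟩ : ∃ a b, b ≠ [] ∧ l = a ++ b ∧
      ∀ a' b', l = a' ++ b' → (a.map f).sum ≤ (a'.map f).sum := by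
    obtain ⟨a, ha, hmin⟩ := Finset.exists_min_image l.inits.toFinset (fun a => (a.map f).sum)
      ⟨[], by simp⟩
    simp only [List.mem_toFinset, List.mem_inits] at ha hmin
    obtain ⟨b, rfl⟩ := ha
    -- A minimum at the end of the list is also attained by the empty prefix, since the total is
    -- zero; cutting there keeps `b` nonempty.
    rcases eq_or_ne b [] with rfl | hb
    · refine ⟨[], a, by simpa using hl, by simp, fun a' b' h => ?_⟩
      have := hmin a' ⟨b', h.symm⟩
      simp only [List.append_nil] at hl0
      simpa [hl0] using this
    · exact ⟨a, b, hb, rfl, fun a' b' h => hmin a' ⟨b', h.symm⟩⟩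
  have key : ∀ p q, p ≠ [] → b ++ a = p ++ q → 0 ≤ (p.map f).sum := by
    intro p q _ h
    rcases List.append_eq_append_iff.1 h with ⟨r, rfl, rfl⟩ | ⟨r, rfl, rfl⟩
    · have := hmin r (q ++ b) (by rw [hab]; simp)
      rw [hab] at hl0
      simp only [List.map_append, List.sum_append] at *
      linarith
    · have := hmin (a ++ p) r (by rw [hab]; simp)
      simp only [List.map_append, List.sum_append] at *
      linarith
  refine ⟨a, b, hb, hab, by simp [hb], fun p q hp hq h => ?_⟩
  have h1 := key p q hp h
  have h2 : (p.map f).sum + (q.map f).sum = 0 := by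
    rw [← List.sum_append, ← List.map_append, ← h, ← hl0, hab]
    simp [add_comm]
  have h3 : (q.map f).sum ≤ 0 := by linarith
  rw [hsum, sum_map_mul_eq hw hp, ← sub_mul] at h1
  rw [hsum, sum_map_mul_eq hw hq, ← sub_mul] at h3
  have h4 := nonneg_of_mul_nonneg_left h1 (sum_map_pos_of_ne_nil hw hp)
  have h5 := nonpos_of_mul_nonpos_left h3 (sum_map_pos_of_ne_nil hw hq)
  linarith

/-- Two cuts divide the cyclic list into two arcs. If both rotations were blocks, each arc would
have mean at most that of the other, against genericity. -/
theorem not_isBlock_rotate_of_lt (hx : IsGenericValues w x) {l : List ι} (hl : l.Nodup)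
    {j k : ℕ} (hjk : j < k) (hk : k < l.length) (h₁ : IsBlock w x (l.rotate j)) :
    ¬ IsBlock w x (l.rotate k) := by
  intro h₂
  obtain ⟨a, m, b, rfl, hm, hb, rfl, rfl⟩ : ∃ a m b, a.length = j ∧ m ≠ [] ∧ b ≠ [] ∧
      l = a ++ (m ++ b) ∧ k = (a ++ m).length := by
    refine ⟨l.take j, (l.drop j).take (k - j), l.drop k, ?_, ?_, ?_, ?_, ?_⟩
    · simp; omega
    · apply List.ne_nil_of_length_pos; simp; omega
    · apply List.ne_nil_of_length_pos; simp; omega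
    · conv_lhs => rw [← List.take_append_drop j l, ← List.take_append_drop (k - j) (l.drop j),
        List.drop_drop, Nat.add_sub_cancel' hjk.le]
    · simp; omega
  rw [← List.append_assoc, List.rotate_append_length_eq] at h₂
  rw [List.rotate_append_length_eq] at h₁
  refine hx m (b ++ a) hm (by simp [hb]) ?_ (le_antisymm ?_ ?_)
  · refine (List.Perm.nodup_iff ?_).1 hl
    rw [← List.append_assoc m]
    exact List.perm_append_comm
  · exact h₂.2 (b ++ a) m (by simp [hb]) hm (by simp)
  · exact h₁.2 m (b ++ a) hm (by simp [hb]) (by simp)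

end Rotation

/-! ### Counting orderings of a finite set by their blocks -/

section Orderings

variable {ι : Type*} [DecidableEq ι]

/-- The lists that enumerate `S` without repetition. -/
noncomputable def orderings (S : Finset ι) : Finset (List ι) := S.toList.permutations.toFinset

theorem mem_orderings {S : Finset ι} {l : List ι} :
    l ∈ orderings S ↔ l.Nodup ∧ l.toFinset = S := by
  rw [orderings, List.mem_toFinset, List.mem_permutations]
  constructor
  · intro h
    exact ⟨h.nodup_iff.2 S.nodup_toList, by rw [List.toFinset_eq_of_perm _ _ h, S.toList_toFinset]⟩
  · rintro ⟨h, rfl⟩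
    exact (List.toFinset_toList h).symm

theorem card_orderings (S : Finset ι) : (orderings S).card = S.card.factorial := by
  rw [orderings, List.toFinset_card_of_nodup (List.nodup_permutations _ S.nodup_toList),
    List.length_permutations, Finset.length_toList]

theorem length_of_mem_orderings {S : Finset ι} {l : List ι} (h : l ∈ orderings S) :
    l.length = S.card := by
  obtain ⟨_, rfl⟩ := mem_orderings.1 h
  exact (List.toFinset_card_of_nodup ‹_›).symm

theorem mem_orderings_of_perm {S : Finset ι} {l l' : List ι} (h : l.Perm l') :
    l ∈ orderings S ↔ l' ∈ orderings S := by
  rw [mem_orderings, mem_orderings, h.nodup_iff, List.toFinset_eq_of_perm _ _ h]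

variable {w x : ι → ℝ}

open Classical in
/-- The enumerations of `S` that form a single block. -/
noncomputable def blockOrderings (w x : ι → ℝ) (S : Finset ι) : Finset (List ι) :=
  (orderings S).filter fun l => IsBlock w x l

theorem mem_blockOrderings {S : Finset ι} {l : List ι} :
    l ∈ blockOrderings w x S ↔ (l.Nodup ∧ l.toFinset = S) ∧ IsBlock w x l := by
  classical
  rw [blockOrderings, Finset.mem_filter, mem_orderings]

/-- Double count the pairs of an ordering `l` and an index `k` for which `l.rotate k` is a block.
Rotation by `k` is a bijection of orderings, and each ordering has exactly one admissible `k`. -/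
theorem card_mul_card_blockOrderings (hw : ∀ i, 0 < w i) (hx : IsGenericValues w x) {S : Finset ι}
    (hS : S.Nonempty) : S.card * (blockOrderings w x S).card = S.card.factorial := by
  classical
  have h1 : ∀ k ∈ Finset.range S.card,
      ((orderings S).filter fun l => IsBlock w x (l.rotate k)).card =
        (blockOrderings w x S).card := by
    intro k hk
    have hk := Finset.mem_range.1 hk
    refine Finset.card_nbij' (fun l => l.rotate k) (fun l => l.rotate (S.card - k)) ?_ ?_ ?_ ?_
    · intro l hl
      simp only [Finset.coe_filter, Set.mem_ofPred_eq] at hl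
      rw [Finset.mem_coe, blockOrderings, Finset.mem_filter,
        mem_orderings_of_perm (List.rotate_perm l k)]
      exact hl
    · intro l hl
      rw [Finset.mem_coe, blockOrderings, Finset.mem_filter] at hl
      have hlen := length_of_mem_orderings hl.1
      rw [Finset.mem_coe, Finset.mem_filter, mem_orderings_of_perm (List.rotate_perm l _),
        List.rotate_rotate, Nat.sub_add_cancel hk.le, ← hlen, List.rotate_length]
      exact hl
    · intro l hl
      rw [Finset.mem_coe, Finset.mem_filter] at hl
      have hlen := length_of_mem_orderings hl.1
      simp only [List.rotate_rotate]
      rw [Nat.add_sub_cancel' hk.le, ← hlen, List.rotate_length]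
    · intro l hl
      rw [Finset.mem_coe, blockOrderings, Finset.mem_filter] at hl
      have hlen := length_of_mem_orderings hl.1
      simp only [List.rotate_rotate]
      rw [Nat.sub_add_cancel hk.le, ← hlen, List.rotate_length]
  have h2 : ∀ l ∈ orderings S,
      ((Finset.range S.card).filter fun k => IsBlock w x (l.rotate k)).card = 1 := by
    intro l hl
    have hlen := length_of_mem_orderings hl
    have hl0 : l ≠ [] := by
      rintro rfl
      simp only [List.length_nil] at hlen
      exact hS.card_pos.ne hlen
    rw [Finset.card_eq_one]
    obtain ⟨a, b, hb, rfl, hab⟩ := exists_isBlock_rotation (x := x) hw hl0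
    have hrot : IsBlock w x ((a ++ b).rotate a.length) := by
      rwa [List.rotate_append_length_eq]
    have hlt : a.length < (a ++ b).length := by
      simpa using List.length_pos_of_ne_nil hb
    refine ⟨a.length, ?_⟩
    ext k
    rw [Finset.mem_filter, Finset.mem_singleton, Finset.mem_range, ← hlen]
    constructor
    · rintro ⟨hk, hkb⟩
      rcases lt_trichotomy k a.length with h | h | h
      · exact absurd hrot (not_isBlock_rotate_of_lt hx (mem_orderings.1 hl).1 h hlt hkb)
      · exact h
      · exact absurd hkb (not_isBlock_rotate_of_lt hx (mem_orderings.1 hl).1 h hk hrot)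
    · rintro rfl
      exact ⟨hlt, hrot⟩
  have h3 := Finset.sum_card_bipartiteAbove_eq_sum_card_bipartiteBelow
    (s := orderings S) (t := Finset.range S.card) fun l k => IsBlock w x (l.rotate k)
  simp only [Finset.bipartiteAbove, Finset.bipartiteBelow] at h3
  rw [Finset.sum_congr rfl h1, Finset.sum_congr rfl h2] at h3
  simpa [card_orderings] using h3.symm

theorem card_blockOrderings (hw : ∀ i, 0 < w i) (hx : IsGenericValues w x) {S : Finset ι}
    (hS : S.Nonempty) : (blockOrderings w x S).card = (S.card - 1).factorial := by
  have h := card_mul_card_blockOrderings hw hx hS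
  rw [← Nat.mul_factorial_pred hS.card_pos.ne'] at h
  exact Nat.eq_of_mul_eq_mul_left hS.card_pos h

end Orderings

/-! ### The recursion for sums over orderings -/

section Recursion

variable {ι : Type*} {w x : ι → ℝ}

/-- The strictly increasing means dictate the order, so a block list is determined by its multiset
of blocks. -/
theorem IsBlockList.eq_of_perm {bs cs : List (List ι)} (hb : IsBlockList w x bs)
    (hc : IsBlockList w x cs) (h : bs.Perm cs) : bs = cs :=
  h.eq_of_pairwise (fun _ _ _ _ h1 h2 => absurd h1 h2.not_gt) hb.2 hc.2

open Classical in
/-- Insert a block into a list of blocks at the position given by its mean. -/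
noncomputable def insertBlock (w x : ι → ℝ) (b : List ι) (bs : List (List ι)) : List (List ι) :=
  bs.orderedInsert (fun a b => listMean w x a ≤ listMean w x b) b

theorem insertBlock_perm (b : List ι) (bs : List (List ι)) :
    (insertBlock w x b bs).Perm (b :: bs) := by
  classical
  exact List.perm_orderedInsert _ _ _

theorem IsBlockList.insertBlock {b : List ι} {bs : List (List ι)} (hbs : IsBlockList w x bs)
    (hb : IsBlock w x b) (h : ∀ c ∈ bs, listMean w x b ≠ listMean w x c) :
    IsBlockList w x (insertBlock w x b bs) := by
  classical
  refine ⟨fun c hc => ?_, ?_⟩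
  · rcases List.mem_cons.1 ((insertBlock_perm b bs).mem_iff.1 hc) with rfl | hc
    · exact hb
    · exact hbs.1 c hc
  · have : Std.Total fun a b : List ι => listMean w x a ≤ listMean w x b :=
      ⟨fun a b => le_total _ _⟩
    have : IsTrans (List ι) fun a b : List ι => listMean w x a ≤ listMean w x b :=
      ⟨fun a b c => le_trans⟩
    have h1 : (ReflArr.insertBlock w x b bs).Pairwise
        fun a b => listMean w x a ≤ listMean w x b :=
      List.Pairwise.orderedInsert b bs (hbs.2.imp fun h => h.le)
    have h2 : (ReflArr.insertBlock w x b bs).Pairwise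
        fun a b => listMean w x a ≠ listMean w x b := by
      refine ((insertBlock_perm b bs).pairwise_iff fun h => h.symm).2 ?_
      exact List.pairwise_cons.2 ⟨h, hbs.2.imp fun h => h.ne⟩
    exact h1.imp₂ (fun _ _ h h' => lt_of_le_of_ne h h') h2

theorem flatten_insertBlock_perm (b : List ι) (bs : List (List ι)) :
    (insertBlock w x b bs).flatten.Perm (b ++ bs.flatten) := by
  simpa using (insertBlock_perm (w := w) (x := x) b bs).flatten

variable [DecidableEq ι] {R : Type*} [CommSemiring R]

/-- The sum over the orderings of `S` of the product of the values of `h` on the blocks. -/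
noncomputable def blockSum (hw : ∀ i, 0 < w i) (x : ι → ℝ) (h : Finset ι → R) (S : Finset ι) : R :=
  ∑ l ∈ orderings S, ((blocks hw x l).map fun b => h b.toFinset).prod

theorem blockSum_empty (hw : ∀ i, 0 < w i) (h : Finset ι → R) : blockSum hw x h ∅ = 1 := by
  have h1 : orderings (∅ : Finset ι) = {[]} := by
    ext l
    rw [mem_orderings, Finset.mem_singleton, List.toFinset_eq_empty_iff]
    exact ⟨fun h => h.2, fun h => by simp [h]⟩
  rw [blockSum, h1, Finset.sum_singleton, (isBlockList_blocks hw []).eq_nil (flatten_blocks hw [])]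
  simp

/-- Split off the block containing `s`, with set of letters `B`. It has `(|B| - 1)!` possible
orders, the other letters are ordered arbitrarily, and genericity leaves exactly one place where the
block can be inserted among the other blocks. -/
theorem blockSum_rec (hw : ∀ i, 0 < w i) (hx : IsGenericValues w x) (h : Finset ι → R)
    {S : Finset ι} {s : ι} (hs : s ∈ S) :
    blockSum hw x h S = ∑ B ∈ S.powerset with s ∈ B,
      ((B.card - 1).factorial : R) * (h B * blockSum hw x h (S \ B)) := by
  classical
  symm
  have h1 : ∀ B ∈ S.powerset.filter (s ∈ ·),
      ((B.card - 1).factorial : R) * (h B * blockSum hw x h (S \ B)) =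
      ∑ bl ∈ blockOrderings w x B ×ˢ orderings (S \ B),
        h B * ((blocks hw x bl.2).map fun b => h b.toFinset).prod := by
    intro B hB
    rw [Finset.sum_product]
    dsimp only
    rw [Finset.sum_const,
      card_blockOrderings hw hx ⟨s, (Finset.mem_filter.1 hB).2⟩, nsmul_eq_mul, blockSum,
      Finset.mul_sum]
  rw [Finset.sum_congr rfl h1, Finset.sum_sigma', blockSum]
  have key : ∀ p : (_ : Finset ι) × (List ι × List ι),
      p ∈ (S.powerset.filter (s ∈ ·)).sigma
        (fun B => blockOrderings w x B ×ˢ orderings (S \ B)) →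
      p.1 = p.2.1.toFinset ∧ s ∈ p.2.1 ∧ s ∉ p.2.2 ∧ IsBlock w x p.2.1 ∧
      (p.2.1 ++ p.2.2) ∈ orderings S ∧
      IsBlockList w x (insertBlock w x p.2.1 (blocks hw x p.2.2)) := by
    rintro ⟨B, b, l⟩ hp
    simp only [Finset.mem_sigma, Finset.mem_filter, Finset.mem_powerset, Finset.mem_product,
      mem_blockOrderings, mem_orderings] at hp ⊢
    obtain ⟨⟨hBS, hsB⟩, ⟨⟨hbn, rfl⟩, hb⟩, hln, hl⟩ := hp
    have hdis : b.Disjoint l := by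
      intro a ha hal
      have : a ∈ S \ b.toFinset := by rw [← hl]; simpa using hal
      simp [ha] at this
    have hn : (b ++ l).Nodup := List.nodup_append'.2 ⟨hbn, hln, hdis⟩
    refine ⟨rfl, by simpa using hsB, fun h => ?_, hb, ⟨hn, ?_⟩, ?_⟩
    · exact hdis (by simpa using hsB) h
    · rw [List.toFinset_append, hl, Finset.union_sdiff_of_subset hBS]
    · have hbl := isBlockList_blocks (x := x) hw l
      refine hbl.insertBlock hb fun c hc => hx b c hb.1 (hbl.1 c hc).1 ?_
      refine hn.sublist (List.Sublist.append_left ?_ b)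
      conv_rhs => rw [← flatten_blocks (x := x) hw l]
      exact List.sublist_flatten_of_mem hc
  refine Finset.sum_bij (fun p _ => (insertBlock w x p.2.1 (blocks hw x p.2.2)).flatten)
    ?_ ?_ ?_ ?_
  · intro p hp
    obtain ⟨-, -, -, -, h2, -⟩ := key p hp
    rw [mem_orderings_of_perm (flatten_insertBlock_perm _ _), flatten_blocks]
    exact h2
  · rintro ⟨B, b, l⟩ hp ⟨B', b', l'⟩ hp' heq
    obtain ⟨h1, h2, h3, h4, h5, h6⟩ := key _ hp
    obtain ⟨h1', h2', h3', h4', h5', h6'⟩ := key _ hp'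
    dsimp only at *
    have h7 := h6.flatten_injective hw h6' heq
    have h8 : (b :: blocks hw x l).Perm (b' :: blocks hw x l') :=
      ((insertBlock_perm _ _).symm.trans (List.Perm.of_eq h7)).trans (insertBlock_perm _ _)
    -- The inserted block is recovered as the one that contains `s`.
    have h9 : b = b' := by
      rcases List.mem_cons.1 (h8.mem_iff.1 List.mem_cons_self) with h | h
      · exact h
      · refine absurd ?_ h3'
        rw [← flatten_blocks (x := x) hw l']
        exact List.mem_flatten_of_mem h h2
    subst h9
    have h10 := (isBlockList_blocks hw l).eq_of_perm (isBlockList_blocks hw l')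
      ((List.perm_cons _).1 h8)
    have h11 : l = l' := by
      rw [← flatten_blocks (x := x) hw l, h10, flatten_blocks]
    subst h11
    rw [h1, h1']
  · intro l hl
    have hl' := mem_orderings.1 hl
    have hbl := isBlockList_blocks (x := x) hw l
    have hsl : s ∈ (blocks hw x l).flatten := by
      rw [flatten_blocks, ← List.mem_toFinset, hl'.2]
      exact hs
    obtain ⟨b, hb, hsb⟩ := List.exists_of_mem_flatten hsl
    -- For surjectivity, erase the block of `s`: what remains is still a block list, hence the
    -- decomposition of its own concatenation.
    have her : IsBlockList w x ((blocks hw x l).erase b) :=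
      ⟨fun c hc => hbl.1 c (List.mem_of_mem_erase hc), hbl.2.sublist List.erase_sublist⟩
    have hperm : (b ++ ((blocks hw x l).erase b).flatten).Perm l := by
      have := (List.perm_cons_erase hb).flatten
      rw [flatten_blocks] at this
      simpa using this.symm
    have hord := mem_orderings.1 ((mem_orderings_of_perm hperm).2 hl)
    obtain ⟨hbn, hen, hdis⟩ := List.nodup_append'.1 hord.1
    refine ⟨⟨b.toFinset, b, ((blocks hw x l).erase b).flatten⟩, ?_, ?_⟩
    · simp only [Finset.mem_sigma, Finset.mem_filter, Finset.mem_powerset, Finset.mem_product,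
        mem_blockOrderings, mem_orderings]
      refine ⟨⟨?_, by simpa using hsb⟩, ⟨⟨hbn, trivial⟩, hbl.1 b hb⟩, hen, ?_⟩
      · rw [← hord.2, List.toFinset_append]
        exact Finset.subset_union_left
      · rw [← hord.2, List.toFinset_append, Finset.union_sdiff_left, eq_comm,
          Finset.sdiff_eq_self_iff_disjoint, Finset.disjoint_left]
        intro a ha hab
        exact hdis (List.mem_toFinset.1 hab) (List.mem_toFinset.1 ha)
    · dsimp only
      rw [her.blocks_flatten hw]
      conv_rhs => rw [← flatten_blocks (x := x) hw l]
      congr 1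
      refine IsBlockList.eq_of_perm (w := w) (x := x) (her.insertBlock (hbl.1 b hb) ?_) hbl
        ((insertBlock_perm _ _).trans (List.perm_cons_erase hb).symm)
      intro c hc
      refine hx b c (hbl.1 b hb).1 (her.1 c hc).1 (hord.1.sublist ?_)
      exact List.Sublist.append_left (List.sublist_flatten_of_mem hc) b
  · intro p hp
    obtain ⟨h1, -, -, -, -, h2⟩ := key p hp
    rw [h2.blocks_flatten, ((insertBlock_perm _ _).map _).prod_eq, List.map_cons, List.prod_cons,
      ← h1]

end Recursion

/-! ### Rising factorials -/

section Rising

/-- Here `j + 1` is the size of the block of a marked letter among `n + 1`: there are `n.choose j`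
choices of its letters and `j!` orders. In the induction the term `j = 0` splits off and the others
are `n + 1` times the previous sum. -/
theorem sum_choose_mul_factorial_mul_prod {R : Type*} [CommRing R] (t : R) (n : ℕ) :
    ∑ j ∈ Finset.range (n + 1), ((n.choose j * j.factorial : ℕ) : R) *
      (t * ∏ i ∈ Finset.range (n - j), (t + i)) = ∏ i ∈ Finset.range (n + 1), (t + i) := by
  induction n with
  | zero => simp
  | succ n ih =>
    have h : ∀ j ∈ Finset.range (n + 1),
        (((n + 1).choose (j + 1) * (j + 1).factorial : ℕ) : R) *
          (t * ∏ i ∈ Finset.range (n + 1 - (j + 1)), (t + i)) =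
        (n + 1 : R) * (((n.choose j * j.factorial : ℕ) : R) *
          (t * ∏ i ∈ Finset.range (n - j), (t + i))) := by
      intro j _
      rw [Nat.factorial_succ, ← mul_assoc ((n + 1).choose _), ← Nat.add_one_mul_choose_eq n j,
        Nat.add_sub_add_right]
      push_cast
      ring
    rw [Finset.sum_range_succ', Finset.sum_congr rfl h, ← Finset.mul_sum, ih,
      Finset.prod_range_succ _ (n + 1)]
    simp only [Nat.choose_zero_right, Nat.factorial_zero, mul_one, Nat.cast_one, one_mul,
      Nat.sub_zero]
    push_cast
    ring

variable {ι R : Type*} [DecidableEq ι] [CommRing R]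

theorem eq_prod_of_rec {G : Finset ι → R} {t : R}
    (hG : ∀ S, ∀ s ∈ S, G S = ∑ B ∈ S.powerset with s ∈ B,
      ((B.card - 1).factorial : R) * (t * G (S \ B))) (S : Finset ι) :
    G S = G ∅ * ∏ i ∈ Finset.range S.card, (t + i) := by
  induction S using Finset.strongInduction with
  | H S ih =>
    rcases S.eq_empty_or_nonempty with rfl | ⟨s, hs⟩
    · simp
    rw [hG S s hs, Finset.sum_filter]
    have hcard : (S.erase s).card + 1 = S.card := Finset.card_erase_add_one hs
    conv_lhs => rw [← Finset.insert_erase hs]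
    -- Only the subsets `insert s T` with `T ⊆ S.erase s` contribute, and their terms depend on
    -- `T.card` alone.
    rw [Finset.sum_powerset_insert (Finset.notMem_erase s S), Finset.sum_eq_zero, zero_add]
    · rw [← hcard, ← sum_choose_mul_factorial_mul_prod, Finset.mul_sum]
      have h : ∀ T ∈ (S.erase s).powerset,
          (if s ∈ insert s T then (((insert s T).card - 1).factorial : R) *
            (t * G (insert s (S.erase s) \ insert s T)) else 0) =
          (fun j : ℕ => (j.factorial : R) * (G ∅ * (t * ∏ i ∈ Finset.range ((S.erase s).card - j),
            (t + i)))) T.card := by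
        intro T hT
        rw [Finset.mem_powerset] at hT
        have hsT : s ∉ T := fun h => Finset.notMem_erase s S (hT h)
        rw [if_pos (Finset.mem_insert_self s T), Finset.card_insert_of_notMem hsT,
          Nat.add_sub_cancel, Finset.insert_erase hs, ih _ ?_]
        · have : (S \ insert s T).card = (S.erase s).card - T.card := by
            rw [← Finset.card_sdiff_of_subset hT, Finset.erase_sdiff_comm, ← Finset.sdiff_insert]
          rw [this]
          ring
        · refine Finset.sdiff_ssubset ?_ ⟨s, Finset.mem_insert_self s T⟩
          exact Finset.insert_subset hs (hT.trans (Finset.erase_subset s S))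
      refine (Finset.sum_congr rfl h).trans ((Finset.sum_powerset_apply_card
        (fun j : ℕ => (j.factorial : R) * (G ∅ * (t * ∏ i ∈ Finset.range ((S.erase s).card - j),
            (t + i))))).trans ?_)
      refine Finset.sum_congr rfl fun j _ => ?_
      rw [nsmul_eq_mul]
      push_cast
      ring
    · intro T hT
      rw [Finset.mem_powerset] at hT
      exact if_neg fun h => Finset.notMem_erase s S (hT h)

theorem blockSum_const {w x : ι → ℝ} (hw : ∀ i, 0 < w i) (hx : IsGenericValues w x) (t : R)
    (S : Finset ι) : blockSum hw x (fun _ => t) S = ∏ i ∈ Finset.range S.card, (t + i) := by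
  rw [eq_prod_of_rec (G := blockSum hw x fun _ => t) (t := t)
    (fun S s hs => blockSum_rec hw hx _ hs) S, blockSum_empty, one_mul]

/-- The blocks depend on the values, but the recursion does not mention them, so the block sum
depends only on the weights `h` of the subsets. -/
theorem blockSum_congr {w x x' : ι → ℝ} (hw : ∀ i, 0 < w i) (hx : IsGenericValues w x)
    (hx' : IsGenericValues w x') {h h' : Finset ι → R} (S : Finset ι)
    (hh : ∀ B ⊆ S, h B = h' B) : blockSum hw x h S = blockSum hw x' h' S := by
  induction S using Finset.strongInduction with
  | H S ih =>
    rcases S.eq_empty_or_nonempty with rfl | ⟨s, hs⟩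
    · rw [blockSum_empty, blockSum_empty]
    rw [blockSum_rec hw hx h hs, blockSum_rec hw hx' h' hs]
    refine Finset.sum_congr rfl fun B hB => ?_
    rw [Finset.mem_filter, Finset.mem_powerset] at hB
    rw [hh B hB.1, ih (S \ B) (Finset.sdiff_ssubset hB.1 ⟨s, hB.2⟩)
      fun C hC => hh C (hC.trans Finset.sdiff_subset)]

/-- Flip the signs of the letters in `B`. -/
def flipSigns (B : Finset ι) (e : ι → ℤˣ) : ι → ℤˣ := fun i => if i ∈ B then -e i else e i

theorem flipSigns_involutive (B : Finset ι) : Function.Involutive (flipSigns B) := by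
  intro e
  ext i
  by_cases h : i ∈ B <;> simp [flipSigns, h]

/-- Attach the signs `e` to the values `x`. -/
def signedValues (e : ι → ℤˣ) (x : ι → ℝ) : ι → ℝ := fun i => ((e i : ℤ) : ℝ) * x i

open Classical in
/-- Weight `t` for the sets of positive mean, and `1` for the others. -/
noncomputable def positiveWeight (w x : ι → ℝ) (t : R) (B : Finset ι) : R :=
  if 0 < ∑ i ∈ B, w i * x i then t else 1

/-- The flip negates the sum over `B`, so exactly one of the two sums is positive. -/
theorem positiveWeight_add_flip {w x : ι → ℝ} (t : R) {B : Finset ι} (e : ι → ℤˣ)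
    (h : ∑ i ∈ B, w i * signedValues e x i ≠ 0) :
    positiveWeight w (signedValues e x) t B +
      positiveWeight w (signedValues (flipSigns B e) x) t B = t + 1 := by
  have h1 : ∑ i ∈ B, w i * signedValues (flipSigns B e) x i =
      -∑ i ∈ B, w i * signedValues e x i := by
    rw [← Finset.sum_neg_distrib]
    refine Finset.sum_congr rfl fun i hi => ?_
    simp [signedValues, flipSigns, hi]
  rw [positiveWeight, positiveWeight, h1]
  rcases h.lt_or_gt with h | h
  · rw [if_neg h.not_gt, if_pos (by linarith), add_comm]
  · rw [if_pos h, if_neg (by linarith)]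

/-- In the recursion, pair `e` with its flip on the split-off block `B`. The weights of `B` add up
to `t + 1 = 2 τ`, while the factor for `S \ B` is unchanged because its weights involve no letter of
`B`. So the sum over signs obeys the recursion with constant weight `τ`. -/
theorem sum_blockSum_positiveWeight [Fintype ι] [IsDomain R] [CharZero R] {w x : ι → ℝ}
    (hw : ∀ i, 0 < w i) (hx : ∀ e, IsGenericValues w (signedValues e x))
    (hx' : ∀ e : ι → ℤˣ, ∀ B : Finset ι, B.Nonempty → ∑ i ∈ B, w i * signedValues e x i ≠ 0)
    {t τ : R} (ht : 2 * τ = t + 1) (S : Finset ι) :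
    ∑ e : ι → ℤˣ, blockSum hw (signedValues e x) (positiveWeight w (signedValues e x) t) S =
      2 ^ Fintype.card ι * ∏ i ∈ Finset.range S.card, (τ + i) := by
  rw [eq_prod_of_rec (G := fun S => ∑ e : ι → ℤˣ, blockSum hw (signedValues e x)
    (positiveWeight w (signedValues e x) t) S) (t := τ) _ S]
  · simp [blockSum_empty]
  intro S s hs
  simp_rw [blockSum_rec hw (hx _) _ hs]
  rw [Finset.sum_comm]
  refine Finset.sum_congr rfl fun B hB => ?_
  rw [Finset.mem_filter, Finset.mem_powerset] at hB
  rw [← Finset.mul_sum]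
  congr 1
  refine mul_left_cancel₀ (two_ne_zero' R) ?_
  rw [← mul_assoc, ht, two_mul]
  -- Of the two copies of the sum, one is reindexed by the flip.
  conv_lhs =>
    enter [2]
    rw [← Equiv.sum_comp (flipSigns_involutive B).toPerm _]
  rw [← Finset.sum_add_distrib, Finset.mul_sum]
  refine Finset.sum_congr rfl fun e _ => ?_
  rw [← positiveWeight_add_flip t e (hx' e B ⟨s, hB.2⟩), add_mul]
  congr 2
  refine blockSum_congr hw (hx _) (hx _) _ fun C hC => ?_
  have h1 : ∑ i ∈ C, w i * signedValues ((flipSigns_involutive B).toPerm _ e) x i =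
      ∑ i ∈ C, w i * signedValues e x i := by
    refine Finset.sum_congr rfl fun i hi => ?_
    have : i ∉ B := (Finset.mem_sdiff.1 (hC hi)).2
    simp [signedValues, flipSigns, this]
  rw [positiveWeight, positiveWeight, h1]

end Rising

/-! ### Isotonic regression along a list -/

section Isotonic

variable {ι : Type*} {w x : ι → ℝ}

/-- Abel summation from the right: the last value of `u` bounds the earlier ones, and raising it to
`M` multiplies a nonnegative partial sum. -/
theorem sum_map_mul_le_of_prefix_nonneg {f u : ι → ℝ} {b : List ι} {M : ℝ}
    (hf : ∀ p q, b = p ++ q → 0 ≤ (p.map f).sum) (hu : b.Pairwise fun i j => u i ≤ u j)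
    (hM : ∀ i ∈ b, u i ≤ M) : (b.map fun i => f i * u i).sum ≤ M * (b.map f).sum := by
  induction b using List.reverseRecOn generalizing M with
  | nil => simp
  | append_singleton b a ih =>
    rw [List.pairwise_append] at hu
    have h1 := ih (M := u a) (fun p q h => hf p (q ++ [a]) (by simp [h])) hu.1
      fun i hi => hu.2.2 i hi a (by simp)
    have h2 := hf (b ++ [a]) [] (by simp)
    have h3 := mul_le_mul_of_nonneg_right (hM a (by simp)) h2
    simp only [List.map_append, List.sum_append, List.map_cons, List.map_nil, List.sum_cons,
      List.sum_nil, add_zero] at h3 ⊢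
    linarith

theorem sum_map_mul_sub (c : ℝ) (l : List ι) : (l.map fun i => w i * (x i - c)).sum =
    (l.map fun i => w i * x i).sum - c * (l.map w).sum := by
  induction l with
  | nil => simp
  | cons a k ih =>
    simp only [List.map_cons, List.sum_cons, ih]
    ring

/-- On a block the partial sums of `w i * (x i - mean)` are nonnegative and the total vanishes. -/
theorem IsBlock.sum_mul_le (hw : ∀ i, 0 < w i) {b : List ι} (hb : IsBlock w x b) {u : ι → ℝ}
    (hu : b.Pairwise fun i j => u i ≤ u j) :
    (b.map fun i => w i * (x i - listMean w x b) * u i).sum ≤ 0 := by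
  classical
  -- Any upper bound will do: it gets multiplied by the total, which is zero.
  obtain ⟨M, hM⟩ := (b.toFinset.finite_toSet.image u).bddAbove
  refine (sum_map_mul_le_of_prefix_nonneg (M := M) ?_ hu
    fun i hi => hM ⟨i, by simpa using hi, rfl⟩).trans_eq ?_
  · rintro p q h
    rcases eq_or_ne p [] with rfl | hp
    · simp
    rw [sum_map_mul_sub, sum_map_mul_eq hw hp, ← sub_mul]
    refine mul_nonneg ?_ (sum_map_pos_of_ne_nil hw hp).le
    rw [h] at hb ⊢
    exact sub_nonneg.2 (hb.listMean_le_prefix hw hp)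
  · rw [sum_map_mul_sub, sum_map_mul_eq hw hb.1, sub_self, mul_zero]

theorem IsBlock.sum_mul_sub_le (hw : ∀ i, 0 < w i) {b : List ι} (hb : IsBlock w x b) {u : ι → ℝ}
    (hu : b.Pairwise fun i j => u i ≤ u j) :
    (b.map fun i => w i * (x i - listMean w x b) * (u i - listMean w x b)).sum ≤ 0 :=
  hb.sum_mul_le hw (u := fun i => u i - listMean w x b)
    (hu.imp fun h => sub_le_sub_right h _)

/-- When the mean is nonpositive the candidate value is `0`; replacing the mean by `0` then only
lowers each term, because `u` is nonnegative. -/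
theorem IsBlock.sum_mul_sub_max_le (hw : ∀ i, 0 < w i) {b : List ι} (hb : IsBlock w x b)
    {u : ι → ℝ} (hu : b.Pairwise fun i j => u i ≤ u j) (hu0 : ∀ i, 0 ≤ u i) :
    (b.map fun i => w i * (x i - max (listMean w x b) 0) *
      (u i - max (listMean w x b) 0)).sum ≤ 0 := by
  rcases le_total 0 (listMean w x b) with h | h
  · rw [max_eq_left h]
    exact hb.sum_mul_sub_le hw hu
  · rw [max_eq_right h]
    refine (List.sum_le_sum fun i _ => ?_).trans (hb.sum_mul_le hw hu)
    have := mul_nonneg (hw i).le (hu0 i)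
    nlinarith

/-- The obtuse angle criterion: expanding the square around `f`, the cross term has the right sign
and the extra square forces uniqueness. -/
theorem sum_sq_le_iff_eq [Fintype ι] (hw : ∀ i, 0 < w i) {K : Set (ι → ℝ)} {f : ι → ℝ}
    (hf : f ∈ K) (h : ∀ u ∈ K, ∑ i, w i * (x i - f i) * (u i - f i) ≤ 0) (z : ι → ℝ) :
    (z ∈ K ∧ ∀ u ∈ K, ∑ i, w i * (z i - x i) ^ 2 ≤ ∑ i, w i * (u i - x i) ^ 2) ↔ z = f := by
  have key : ∀ u : ι → ℝ, ∑ i, w i * (u i - x i) ^ 2 = ∑ i, w i * (f i - x i) ^ 2 +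
      ∑ i, w i * (u i - f i) ^ 2 - 2 * ∑ i, w i * (x i - f i) * (u i - f i) := by
    intro u
    rw [Finset.mul_sum, ← Finset.sum_add_distrib, ← Finset.sum_sub_distrib]
    exact Finset.sum_congr rfl fun i _ => by ring
  have hnn : ∀ u : ι → ℝ, ∀ i ∈ Finset.univ, 0 ≤ w i * (u i - f i) ^ 2 :=
    fun u i _ => mul_nonneg (hw i).le (sq_nonneg _)
  constructor
  · rintro ⟨hz, hmin⟩
    have h1 := hmin f hf
    rw [key z] at h1
    have h2 := h z hz
    have h3 : ∑ i, w i * (z i - f i) ^ 2 = 0 :=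
      le_antisymm (by linarith) (Finset.sum_nonneg (hnn z))
    funext i
    have h4 := (Finset.sum_eq_zero_iff_of_nonneg (hnn z)).1 h3 i (Finset.mem_univ i)
    have h5 := (mul_eq_zero.1 h4).resolve_left (hw i).ne'
    exact sub_eq_zero.1 (pow_eq_zero_iff two_ne_zero |>.1 h5)
  · rintro rfl
    refine ⟨hf, fun u hu => ?_⟩
    rw [key u]
    have h2 := h u hu
    have h3 := Finset.sum_nonneg (hnn u)
    linarith

variable [DecidableEq ι]

/-- The mean of the block of `l` that contains the letter `i`. -/
noncomputable def blockMean (hw : ∀ i, 0 < w i) (x : ι → ℝ) (l : List ι) (i : ι) : ℝ :=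
  listMean w x (((blocks hw x l).find? fun b => i ∈ b).getD [])

theorem blockMean_eq (hw : ∀ i, 0 < w i) {l : List ι} (hl : l.Nodup) {b : List ι}
    (hb : b ∈ blocks hw x l) {i : ι} (hi : i ∈ b) : blockMean hw x l i = listMean w x b := by
  rw [blockMean]
  obtain ⟨c, hc⟩ : ∃ c, (blocks hw x l).find? (fun b => i ∈ b) = some c := by
    rw [← Option.isSome_iff_exists, List.find?_isSome]
    exact ⟨b, hb, by simpa using hi⟩
  rw [hc, Option.getD_some]
  have h1 := List.mem_of_find?_eq_some hc
  have h2 : i ∈ c := by simpa using List.find?_some hc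
  by_contra hne
  have hcb : c ≠ b := fun h => hne (by rw [h])
  rw [← flatten_blocks (x := x) hw l, List.nodup_flatten] at hl
  have : Std.Symm (List.Disjoint (α := ι)) := ⟨fun _ _ h => h.symm⟩
  exact hl.2.forall h1 hb hcb h2 hi

theorem pairwise_blockMean (hw : ∀ i, 0 < w i) {l : List ι} (hl : l.Nodup) :
    l.Pairwise fun i j => blockMean hw x l i ≤ blockMean hw x l j := by
  conv => arg 2; rw [← flatten_blocks (x := x) hw l]
  rw [List.pairwise_flatten]
  have hb := isBlockList_blocks (x := x) hw l
  constructor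
  · intro b hb
    refine List.pairwise_of_forall_mem_list fun i hi j hj => ?_
    rw [blockMean_eq hw hl hb hi, blockMean_eq hw hl hb hj]
  · refine hb.2.imp_of_mem fun {b c} hb hc h i hi j hj => ?_
    rw [blockMean_eq hw hl hb hi, blockMean_eq hw hl hc hj]
    exact h.le

variable [Fintype ι]

theorem sum_univ_le_zero_of_blocks (hw : ∀ i, 0 < w i) {l : List ι} (hl : l.Nodup)
    (hmem : ∀ i, i ∈ l) {F : ι → ℝ} (hF : ∀ b ∈ blocks hw x l, (b.map F).sum ≤ 0) :
    ∑ i, F i ≤ 0 := by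
  have h1 : l.toFinset = Finset.univ := by ext i; simp [hmem]
  rw [← h1, List.sum_toFinset _ hl, ← flatten_blocks (x := x) hw l, List.map_flatten,
    List.sum_flatten]
  rw [List.map_map]
  exact (List.sum_le_sum (g := fun _ => (0 : ℝ)) hF).trans_eq (by simp)

theorem isotonic_iff (hw : ∀ i, 0 < w i) {l : List ι} (hl : l.Nodup) (hmem : ∀ i, i ∈ l)
    (z : ι → ℝ) :
    (z ∈ {u : ι → ℝ | l.Pairwise fun i j => u i ≤ u j} ∧
      ∀ u ∈ {u : ι → ℝ | l.Pairwise fun i j => u i ≤ u j},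
        ∑ i, w i * (z i - x i) ^ 2 ≤ ∑ i, w i * (u i - x i) ^ 2) ↔ z = blockMean hw x l := by
  refine sum_sq_le_iff_eq hw (pairwise_blockMean hw hl) (fun u hu => ?_) z
  refine sum_univ_le_zero_of_blocks (x := x) hw hl hmem fun b hb => ?_
  have h1 := isBlockList_blocks (x := x) hw l
  refine Eq.trans_le ?_ ((h1.1 b hb).sum_mul_sub_le hw (u := u) ?_)
  · refine congrArg List.sum (List.map_congr_left fun i hi => ?_)
    rw [blockMean_eq hw hl hb hi]
  · refine List.Pairwise.sublist ?_ hu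
    conv_rhs => rw [← flatten_blocks (x := x) hw l]
    exact List.sublist_flatten_of_mem hb

theorem nonneg_isotonic_iff (hw : ∀ i, 0 < w i) {l : List ι} (hl : l.Nodup) (hmem : ∀ i, i ∈ l)
    (z : ι → ℝ) :
    (z ∈ {u : ι → ℝ | (l.Pairwise fun i j => u i ≤ u j) ∧ ∀ i, 0 ≤ u i} ∧
      ∀ u ∈ {u : ι → ℝ | (l.Pairwise fun i j => u i ≤ u j) ∧ ∀ i, 0 ≤ u i},
        ∑ i, w i * (z i - x i) ^ 2 ≤ ∑ i, w i * (u i - x i) ^ 2) ↔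
      z = fun i => max (blockMean hw x l i) 0 := by
  refine sum_sq_le_iff_eq hw ?_ (fun u hu => ?_) z
  · exact ⟨(pairwise_blockMean hw hl).imp fun h => max_le_max_right 0 h, fun i => le_max_right _ _⟩
  refine sum_univ_le_zero_of_blocks (x := x) hw hl hmem fun b hb => ?_
  have h1 := isBlockList_blocks (x := x) hw l
  refine Eq.trans_le ?_ ((h1.1 b hb).sum_mul_sub_max_le hw (u := u) ?_ hu.2)
  · refine congrArg List.sum (List.map_congr_left fun i hi => ?_)
    rw [blockMean_eq hw hl hb hi]
  · refine List.Pairwise.sublist ?_ hu.1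
    conv_rhs => rw [← flatten_blocks (x := x) hw l]
    exact List.sublist_flatten_of_mem hb

theorem image_blockMean (hw : ∀ i, 0 < w i) {l : List ι} (hl : l.Nodup) (hmem : ∀ i, i ∈ l) :
    Finset.univ.image (blockMean hw x l) = ((blocks hw x l).map (listMean w x)).toFinset := by
  have h1 := isBlockList_blocks (x := x) hw l
  ext c
  simp only [Finset.mem_image, Finset.mem_univ, true_and, List.mem_toFinset, List.mem_map]
  constructor
  · rintro ⟨i, rfl⟩
    have hi := hmem i
    rw [← flatten_blocks (x := x) hw l] at hi
    obtain ⟨b, hb, hib⟩ := List.exists_of_mem_flatten hi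
    exact ⟨b, hb, (blockMean_eq hw hl hb hib).symm⟩
  · rintro ⟨b, hb, rfl⟩
    obtain ⟨i, hi⟩ := List.exists_mem_of_ne_nil b (h1.1 b hb).1
    exact ⟨i, blockMean_eq hw hl hb hi⟩

theorem card_image_blockMean (hw : ∀ i, 0 < w i) {l : List ι} (hl : l.Nodup)
    (hmem : ∀ i, i ∈ l) :
    (Finset.univ.image (blockMean hw x l)).card = (blocks hw x l).length := by
  rw [image_blockMean hw hl hmem, List.toFinset_card_of_nodup, List.length_map]
  exact List.pairwise_map.2 ((isBlockList_blocks hw l).2.imp fun h => h.ne)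

/-- Truncation sends all blocks of nonpositive mean to the erased value `0` and keeps the positive
means, which are distinct. -/
theorem card_image_max_blockMean (hw : ∀ i, 0 < w i) {l : List ι} (hl : l.Nodup)
    (hmem : ∀ i, i ∈ l) :
    ((Finset.univ.image fun i => max (blockMean hw x l i) 0).erase 0).card =
      (blocks hw x l).countP fun b => 0 < listMean w x b := by
  have h1 : (Finset.univ.image fun i => max (blockMean hw x l i) 0).erase 0 =
      (Finset.univ.image (blockMean hw x l)).filter (0 < ·) := by
    ext c
    simp only [Finset.mem_erase, Finset.mem_image, Finset.mem_univ, true_and, Finset.mem_filter]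
    constructor
    · rintro ⟨hc, i, rfl⟩
      have h2 := (le_max_right (blockMean hw x l i) 0).lt_of_ne hc.symm
      rcases lt_max_iff.1 h2 with h | h
      · exact ⟨⟨i, (max_eq_left h.le).symm⟩, h2⟩
      · exact absurd h (lt_irrefl _)
    · rintro ⟨⟨i, rfl⟩, hc⟩
      exact ⟨hc.ne', i, max_eq_left hc.le⟩
  have h2 : ((blocks hw x l).map (listMean w x)).toFinset.filter (0 < ·) =
      (((blocks hw x l).map (listMean w x)).filter (0 < ·)).toFinset := by
    ext c
    simp
  rw [h1, image_blockMean hw hl hmem, List.countP_eq_length_filter, h2,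
    List.toFinset_card_of_nodup, List.filter_map, List.length_map]
  · rfl
  · refine List.Nodup.filter _ ?_
    exact List.pairwise_map.2 ((isBlockList_blocks hw l).2.imp fun h => h.ne)

end Isotonic

/-! ### The number of orderings with a given number of blocks -/

section Counting

theorem coeff_prod_X_sub_C (a : ℕ → ℤ) (n k : ℕ) :
    (∏ j ∈ Finset.range n, (X - C (a j))).coeff k =
      (-1) ^ (n + k) * (∏ j ∈ Finset.range n, (X + C (a j))).coeff k := by
  induction n generalizing k with
  | zero =>
    cases k with
    | zero => simp
    | succ k => simp [coeff_one]
  | succ n ih =>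
    rw [Finset.prod_range_succ, Finset.prod_range_succ]
    cases k with
    | zero =>
      simp only [mul_coeff_zero, ih, coeff_sub, coeff_add, coeff_X_zero, coeff_C_zero]
      ring
    | succ k =>
      rw [coeff_mul_X_sub_C, mul_add, coeff_add, coeff_mul_X, coeff_mul_C, ih, ih]
      ring

theorem coeff_prod_X_add_C_nonneg {a : ℕ → ℤ} (ha : ∀ j, 0 ≤ a j) (n k : ℕ) :
    0 ≤ (∏ j ∈ Finset.range n, (X + C (a j))).coeff k := by
  induction n generalizing k with
  | zero =>
    rw [Finset.prod_range_zero, coeff_one]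
    split_ifs <;> simp
  | succ n ih =>
    rw [Finset.prod_range_succ, mul_add, coeff_add, coeff_mul_C]
    refine add_nonneg ?_ (mul_nonneg (ih k) (ha n))
    cases k with
    | zero => simp
    | succ k => rw [coeff_mul_X]; exact ih k

theorem abs_coeff_prod_X_sub_C {a : ℕ → ℤ} (ha : ∀ j, 0 ≤ a j) (n k : ℕ) :
    |(∏ j ∈ Finset.range n, (X - C (a j))).coeff k| =
      (∏ j ∈ Finset.range n, (X + C (a j))).coeff k := by
  rw [coeff_prod_X_sub_C, abs_mul, abs_pow, abs_neg, abs_one, one_pow, one_mul,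
    abs_of_nonneg (coeff_prod_X_add_C_nonneg ha n k)]

theorem nodup_ofFn_perm {m : ℕ} (σ : Equiv.Perm (Fin m)) : (List.ofFn σ).Nodup :=
  List.nodup_ofFn.2 σ.injective

theorem mem_ofFn_perm {m : ℕ} (σ : Equiv.Perm (Fin m)) (i : Fin m) : i ∈ List.ofFn σ :=
  List.mem_ofFn.2 (σ.surjective i)

theorem sum_orderings_univ {m : ℕ} {M : Type*} [AddCommMonoid M] (f : List (Fin m) → M) :
    ∑ l ∈ orderings Finset.univ, f l = ∑ σ : Equiv.Perm (Fin m), f (List.ofFn σ) := by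
  have hinj : Function.Injective fun σ : Equiv.Perm (Fin m) => List.ofFn σ :=
    fun σ τ h => DFunLike.coe_injective (List.ofFn_injective h)
  have h : Finset.univ.image (fun σ : Equiv.Perm (Fin m) => List.ofFn σ) =
      orderings Finset.univ := by
    refine Finset.eq_of_subset_of_card_le ?_ ?_
    · intro l hl
      obtain ⟨σ, -, rfl⟩ := Finset.mem_image.1 hl
      refine mem_orderings.2 ⟨nodup_ofFn_perm σ, ?_⟩
      ext i
      simpa using mem_ofFn_perm σ i
    · rw [card_orderings, Finset.card_image_of_injective _ hinj, Finset.card_univ, Finset.card_univ,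
        Fintype.card_perm]
  rw [← h, Finset.sum_image hinj.injOn]

theorem card_perm_blocks {m : ℕ} {w x : Fin m → ℝ} (hw : ∀ i, 0 < w i)
    (hx : IsGenericValues w x) (k : ℕ) :
    (Finset.card {σ : Equiv.Perm (Fin m) | (blocks hw x (List.ofFn σ)).length = k} : ℤ) =
      |(∏ j ∈ Finset.range m, (X - C (j : ℤ))).coeff k| := by
  have h := blockSum_const hw hx (X : ℤ[X]) Finset.univ
  rw [blockSum, sum_orderings_univ] at h
  simp only [List.map_const', List.prod_replicate, Finset.card_univ, Fintype.card_fin] at h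
  rw [abs_coeff_prod_X_sub_C (fun j => Int.natCast_nonneg j)]
  simp only [map_natCast]
  rw [← h, finsetSum_coeff]
  simp only [coeff_X_pow, Finset.card_filter, eq_comm (a := k)]
  push_cast
  rfl

theorem prod_map_positiveWeight {ι R : Type*} [DecidableEq ι] [CommRing R] {w x : ι → ℝ}
    (hw : ∀ i, 0 < w i) (t : R) {bs : List (List ι)} (hbs : ∀ b ∈ bs, b ≠ [] ∧ b.Nodup) :
    (bs.map fun b => positiveWeight w x t b.toFinset).prod =
      t ^ bs.countP fun b => 0 < listMean w x b := by
  induction bs with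
  | nil => simp
  | cons b bs ih =>
    have hb := hbs b (by simp)
    have hpos := sum_map_pos_of_ne_nil hw hb.1
    have h : 0 < ∑ i ∈ b.toFinset, w i * x i ↔ 0 < listMean w x b := by
      rw [List.sum_toFinset _ hb.2, sum_map_mul_eq hw hb.1, mul_pos_iff_of_pos_right hpos]
    rw [List.map_cons, List.prod_cons, ih fun c hc => hbs c (by simp [hc]), positiveWeight,
      List.countP_cons]
    by_cases h' : 0 < listMean w x b
    · simp [h, h', pow_succ']
    · simp [h, h']

/-- Coefficient extraction from `sum_blockSum_positiveWeight` at `t = X`. The half in `τ = (X + 1) /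
2` requires rational coefficients; the power `2 ^ m` clears it again. -/
theorem card_signed_perm_blocks {m : ℕ} {w x : Fin m → ℝ} (hw : ∀ i, 0 < w i)
    (hx : ∀ e, IsGenericValues w (signedValues e x))
    (hx' : ∀ e : Fin m → ℤˣ, ∀ B : Finset (Fin m), B.Nonempty →
      ∑ i ∈ B, w i * signedValues e x i ≠ 0) (k : ℕ) :
    (Finset.card {p : (Fin m → ℤˣ) × Equiv.Perm (Fin m) |
      ((blocks hw (signedValues p.1 x) (List.ofFn p.2)).countP fun b =>
        0 < listMean w (signedValues p.1 x) b) = k} : ℤ) =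
      |(∏ j ∈ Finset.range m, (X - C (2 * (j : ℤ) + 1))).coeff k| := by
  have h := sum_blockSum_positiveWeight hw hx hx' (t := (X : ℚ[X])) (τ := C (1 / 2) * (X + 1))
    (by rw [← mul_assoc, ← C_ofNat, ← C_mul]; norm_num) Finset.univ
  have h1 : ∀ (e : Fin m → ℤˣ) (l : List (Fin m)), l ∈ orderings Finset.univ →
      ((blocks hw (signedValues e x) l).map fun b =>
        positiveWeight w (signedValues e x) (X : ℚ[X]) b.toFinset).prod =
      X ^ (blocks hw (signedValues e x) l).countP fun b =>
        0 < listMean w (signedValues e x) b := by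
    intro e l hl
    refine prod_map_positiveWeight hw X fun b hb =>
      ⟨((isBlockList_blocks hw l).1 b hb).1, ?_⟩
    have hl := (mem_orderings.1 hl).1
    rw [← flatten_blocks (x := signedValues e x) hw l] at hl
    exact hl.sublist (List.sublist_flatten_of_mem hb)
  have h2 : ∀ e : Fin m → ℤˣ, blockSum hw (signedValues e x)
      (positiveWeight w (signedValues e x) (X : ℚ[X])) Finset.univ =
      ∑ σ : Equiv.Perm (Fin m), X ^ (blocks hw (signedValues e x) (List.ofFn σ)).countP fun b =>
        0 < listMean w (signedValues e x) b := by
    intro e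
    rw [blockSum, Finset.sum_congr rfl (h1 e), sum_orderings_univ]
  simp only [h2, Finset.card_univ, Fintype.card_fin] at h
  have h3 : (2 ^ m * ∏ i ∈ Finset.range m, (C (1 / 2) * (X + 1) + (i : ℚ[X]))) =
      (∏ j ∈ Finset.range m, (X + C (2 * (j : ℤ) + 1))).map (Int.castRingHom ℚ) := by
    have h4 : (2 ^ m : ℚ[X]) = ∏ i ∈ Finset.range m, 2 := by simp
    rw [h4, ← Finset.prod_mul_distrib, Polynomial.map_prod]
    refine Finset.prod_congr rfl fun i _ => ?_
    have h5 : (2 : ℚ[X]) * C (1 / 2) = 1 := by rw [← C_ofNat, ← C_mul]; norm_num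
    have h6 : (X + C (2 * (i : ℤ) + 1)).map (Int.castRingHom ℚ) = X + 2 * (i : ℚ[X]) + 1 := by
      simp [add_assoc]
    rw [h6]
    linear_combination (X + 1) * h5
  rw [h3, ← Fintype.sum_prod_type', eq_comm] at h
  rw [abs_coeff_prod_X_sub_C fun j => by positivity]
  have h7 := congrArg (fun p => p.coeff k) h
  simp only [coeff_map, finsetSum_coeff, coeff_X_pow, Int.coe_castRingHom] at h7
  rw [← Int.cast_inj (α := ℚ), h7, Finset.card_filter]
  simp only [eq_comm (a := k)]
  push_cast
  rfl

end Counting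

/-! ### Faces of polyhedral cones -/

section PolyhedralCone

open Filter Topology

variable {V : Type*} [NormedAddCommGroup V] [InnerProductSpace ℝ V] {I : Type*}

/-- The polyhedral cone on which the functionals `ℓ i` are nonnegative. -/
def polyhedralCone (ℓ : I → V →L[ℝ] ℝ) : Set V := {y | ∀ i, 0 ≤ ℓ i y}

/-- The subspace on which all the functionals that vanish at `z` vanish. -/
def activeSpace (ℓ : I → V →L[ℝ] ℝ) (z : V) : Submodule ℝ V where
  carrier := {y | ∀ i, ℓ i z = 0 → ℓ i y = 0}
  add_mem' ha hb i hi := by rw [map_add, ha i hi, hb i hi, add_zero]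
  zero_mem' i _ := map_zero _
  smul_mem' c a ha i hi := by rw [map_smul, ha i hi, smul_zero]

theorem mem_activeSpace {ℓ : I → V →L[ℝ] ℝ} {z y : V} :
    y ∈ activeSpace ℓ z ↔ ∀ i, ℓ i z = 0 → ℓ i y = 0 := Iff.rfl

theorem eventually_add_smul_mem_polyhedralCone [Finite I] {ℓ : I → V →L[ℝ] ℝ} {z y : V}
    (hz : z ∈ polyhedralCone ℓ) (hy : y ∈ activeSpace ℓ z) :
    ∀ᶠ t : ℝ in 𝓝 0, z + t • y ∈ polyhedralCone ℓ := by
  refine eventually_all.2 fun i => ?_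
  rcases (hz i).eq_or_lt with h | h
  · refine Eventually.of_forall fun t => ?_
    rw [map_add, map_smul, hy i h.symm, ← h, smul_zero, add_zero]
  · have hc : Continuous fun t : ℝ => ℓ i (z + t • y) := by fun_prop
    have h0 : 0 < ℓ i (z + (0 : ℝ) • y) := by simpa using h
    exact (hc.tendsto 0).eventually (lt_mem_nhds h0) |>.mono fun t ht => ht.le

theorem isExposed_polyhedralCone_inter_activeSpace [Finite I] (ℓ : I → V →L[ℝ] ℝ)
    (z : V) : IsExposed ℝ (polyhedralCone ℓ) (polyhedralCone ℓ ∩ activeSpace ℓ z) := by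
  classical
  have := Fintype.ofFinite I
  intro _
  -- On the cone this functional is nonpositive, and it reaches its maximum `0` exactly where every
  -- functional active at `z` vanishes.
  refine ⟨-∑ i with ℓ i z = 0, ℓ i, ?_⟩
  ext y
  have h1 : ∀ u : V, (-∑ i with ℓ i z = 0, ℓ i) u = -∑ i with ℓ i z = 0, ℓ i u := by
    intro u
    simp
  simp only [h1, Set.mem_inter_iff, Set.mem_ofPred_eq, neg_le_neg_iff]
  refine and_congr_right fun hy => ⟨fun hyz u hu => ?_, fun h i hi => ?_⟩
  · rw [Finset.sum_eq_zero fun i hi => hyz i (Finset.mem_filter.1 hi).2]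
    exact Finset.sum_nonneg fun i _ => hu i
  · have h2 := h 0 fun i => by simp
    simp only [map_zero, Finset.sum_const_zero] at h2
    have h3 := (Finset.sum_eq_zero_iff_of_nonneg fun i _ => hy i).1
      (le_antisymm h2 (Finset.sum_nonneg fun i _ => hy i))
    exact h3 i (by simpa using hi)

theorem vectorSpan_polyhedralCone_inter_activeSpace [Finite I] {ℓ : I → V →L[ℝ] ℝ} {z : V}
    (hz : z ∈ polyhedralCone ℓ) :
    vectorSpan ℝ (polyhedralCone ℓ ∩ activeSpace ℓ z) = activeSpace ℓ z := by
  have hzz : z ∈ activeSpace ℓ z := fun i hi => hi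
  apply le_antisymm
  · rw [vectorSpan_def, Submodule.span_le]
    rintro _ ⟨a, ha, b, hb, rfl⟩
    exact Submodule.sub_mem _ ha.2 hb.2
  · intro y hy
    have h1 := (eventually_add_smul_mem_polyhedralCone hz hy).filter_mono
      (nhdsWithin_le_nhds (s := Set.Ioi 0))
    obtain ⟨t, ht, ht0⟩ := (h1.and self_mem_nhdsWithin).exists
    have h2 : z + t • y ∈ polyhedralCone ℓ ∩ activeSpace ℓ z :=
      ⟨ht, Submodule.add_mem _ hzz (Submodule.smul_mem _ t hy)⟩
    have h3 := vsub_mem_vectorSpan ℝ h2 ⟨hz, hzz⟩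
    rw [vsub_eq_sub, add_sub_cancel_left] at h3
    exact (Submodule.smul_mem_iff _ (ne_of_gt ht0)).1 h3

theorem mem_intrinsicInterior_polyhedralCone [Finite I] {ℓ : I → V →L[ℝ] ℝ} {z : V}
    (hz : z ∈ polyhedralCone ℓ) :
    z ∈ intrinsicInterior ℝ (polyhedralCone ℓ ∩ activeSpace ℓ z) := by
  have hzz : z ∈ activeSpace ℓ z := fun i hi => hi
  have hsub : affineSpan ℝ (polyhedralCone ℓ ∩ activeSpace ℓ z) ≤
      (activeSpace ℓ z).toAffineSubspace := affineSpan_le.2 fun y hy => hy.2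
  rw [mem_intrinsicInterior]
  refine ⟨⟨z, subset_affineSpan ℝ _ ⟨hz, hzz⟩⟩, ?_, rfl⟩
  rw [mem_interior_iff_mem_nhds, mem_nhds_subtype]
  refine ⟨{y | ∀ i, ℓ i z ≠ 0 → 0 < ℓ i y}, ?_, ?_⟩
  · refine eventually_all.2 fun i => ?_
    by_cases hi : ℓ i z = 0
    · exact Eventually.of_forall fun y h => absurd hi h
    · exact ((ℓ i).continuous.tendsto z).eventually (lt_mem_nhds ((hz i).lt_of_ne' hi))
        |>.mono fun y hy _ => hy
  · rintro ⟨y, hy⟩ hpos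
    have hy' : y ∈ activeSpace ℓ z := hsub hy
    refine ⟨fun i => ?_, hy'⟩
    by_cases hi : ℓ i z = 0
    · exact (hy' i hi).ge
    · exact (hpos i hi).le

/-- A face is determined by any of its relative interior points `z`. From `z` one can move slightly
away from `y ∈ F` inside `F`, so a constraint active at `z` vanishes at `y`. Conversely, for `y` in
the right-hand side the same move stays in the cone, so the exposing functional cannot be smaller at
`y` than at `z`. -/
theorem eq_polyhedralCone_inter_activeSpace [Finite I] {ℓ : I → V →L[ℝ] ℝ} {F : Set V} {z : V}
    (hF : IsExposed ℝ (polyhedralCone ℓ) F) (hz : z ∈ intrinsicInterior ℝ F) :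
    F = polyhedralCone ℓ ∩ activeSpace ℓ z := by
  have hzF : z ∈ F := intrinsicInterior_subset hz
  have hsub : F ⊆ polyhedralCone ℓ := hF.subset
  apply Set.Subset.antisymm
  · intro y hy
    refine ⟨hsub hy, fun i hi => ?_⟩
    obtain ⟨⟨z', hz'⟩, hint, hzz⟩ := mem_intrinsicInterior.1 hz
    dsimp only at hzz
    subst hzz
    have hya := subset_affineSpan ℝ F hy
    set f : ℝ → affineSpan ℝ F :=
      fun t => ⟨AffineMap.lineMap z' y t, AffineMap.lineMap_mem t hz' hya⟩ with hf
    have hfc : Continuous f := AffineMap.lineMap_continuous.subtype_mk _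
    have hf0 : f 0 = ⟨z', hz'⟩ := by simp [hf]
    have h1 : ∀ᶠ t in 𝓝 (0 : ℝ), (f t : V) ∈ F := by
      have h2 : ((↑) : affineSpan ℝ F → V) ⁻¹' F ∈ 𝓝 (f 0) := by
        rw [hf0]
        exact mem_interior_iff_mem_nhds.1 hint
      exact hfc.tendsto 0 h2
    obtain ⟨t, ht, ht0⟩ := ((h1.filter_mono (nhdsWithin_le_nhds (s := Set.Iio 0))).and
      self_mem_nhdsWithin).exists
    have h2 := hsub ht i
    simp only [hf, AffineMap.lineMap_apply_module, map_add, map_smul, hi,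
      smul_eq_mul, mul_zero, zero_add] at h2
    exact le_antisymm (nonpos_of_mul_nonneg_right h2 ht0) (hsub hy i)
  · rintro y ⟨hy, hyz⟩
    obtain ⟨l, hl⟩ := hF ⟨z, hzF⟩
    have hzmax : ∀ u ∈ polyhedralCone ℓ, l u ≤ l z := by
      have h := hzF
      rw [hl] at h
      exact h.2
    have hzz : z ∈ activeSpace ℓ z := fun i hi => hi
    have h1 := (eventually_add_smul_mem_polyhedralCone (hsub hzF)
      (Submodule.sub_mem _ hyz hzz)).filter_mono (nhdsWithin_le_nhds (s := Set.Iio 0))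
    obtain ⟨t, ht, ht0⟩ := (h1.and self_mem_nhdsWithin).exists
    have h2 := hzmax _ ht
    rw [map_add, map_smul, map_sub, smul_eq_mul] at h2
    have h3 : 0 ≤ l y - l z := nonneg_of_mul_nonpos_right (by linarith) ht0
    rw [hl]
    exact ⟨hy, fun u hu => (hzmax u hu).trans (by linarith)⟩

theorem isKDimensional_polyhedralCone_iff [Finite I] (ℓ : I → V →L[ℝ] ℝ) (z : V) (k : ℕ) :
    IsKDimensional (polyhedralCone ℓ) z k ↔
      z ∈ polyhedralCone ℓ ∧ Module.finrank ℝ (activeSpace ℓ z) = k := by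
  constructor
  · rintro ⟨F, hFK, hF, hk, hz⟩
    have hzK := hFK (intrinsicInterior_subset hz)
    rw [eq_polyhedralCone_inter_activeSpace hF hz,
      vectorSpan_polyhedralCone_inter_activeSpace hzK] at hk
    exact ⟨hzK, hk⟩
  · rintro ⟨hz, hk⟩
    refine ⟨_, Set.inter_subset_left, isExposed_polyhedralCone_inter_activeSpace ℓ z, ?_,
      mem_intrinsicInterior_polyhedralCone hz⟩
    rw [vectorSpan_polyhedralCone_inter_activeSpace hz, hk]

/-- On a connected subset of `U` no functional changes sign, and the open cone is convex, so it is
the component. Points `y + t • p` with small `t > 0` approximate `y` in the closed cone. -/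
theorem closure_connectedComponentIn_eq_polyhedralCone {ℓ : I → V →L[ℝ] ℝ} {U : Set V}
    (hU : ∀ y, y ∈ U ↔ ∀ i, ℓ i y ≠ 0) {p : V} (hp : ∀ i, 0 < ℓ i p) :
    closure (connectedComponentIn U p) = polyhedralCone ℓ := by
  have hpU : p ∈ U := (hU p).2 fun i => (hp i).ne'
  have h1 : connectedComponentIn U p = {y | ∀ i, 0 < ℓ i y} := by
    apply Set.Subset.antisymm
    · intro y hy i
      by_contra! hle
      have hconn : IsPreconnected (ℓ i '' connectedComponentIn U p) :=
        isPreconnected_connectedComponentIn.image _ (ℓ i).continuous.continuousOn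
      have h0 := hconn.ordConnected.out ⟨y, hy, rfl⟩
        ⟨p, mem_connectedComponentIn hpU, rfl⟩ ⟨hle, (hp i).le⟩
      obtain ⟨u, hu, hu0⟩ := h0
      exact (hU u).1 (connectedComponentIn_subset U p hu) i hu0
    · have hconv : Convex ℝ {y : V | ∀ i, 0 < ℓ i y} := by
        rw [Set.ofPred_forall]
        exact convex_iInter fun i => convex_halfSpace_gt (ℓ i).isLinear 0
      exact hconv.isPreconnected.subset_connectedComponentIn hp
        fun y hy => (hU y).2 fun i => (hy i).ne'
  rw [h1]
  apply Set.Subset.antisymm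
  · refine closure_minimal (fun y hy i => (hy i).le) ?_
    rw [polyhedralCone, Set.ofPred_forall]
    exact isClosed_iInter fun i => isClosed_le continuous_const (ℓ i).continuous
  · intro y hy
    have hc : Tendsto (fun t : ℝ => y + t • p) (𝓝[>] 0) (𝓝 y) := by
      have : Continuous fun t : ℝ => y + t • p := by fun_prop
      simpa using (this.tendsto 0).mono_left nhdsWithin_le_nhds
    refine mem_closure_of_tendsto hc (eventually_nhdsWithin_of_forall fun t ht i => ?_)
    rw [map_add, map_smul, smul_eq_mul]
    exact add_pos_of_nonneg_of_pos (hy i) (mul_pos ht (hp i))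

end PolyhedralCone

/-! ### Evaluation of the characteristic polynomial by counting points -/

section PointCount

variable {V : Type*} [AddCommGroup V] [Module ℝ V]

open Classical in
theorem sum_moebius_le (A : Finset (Submodule ℝ V)) (X : IntersectionLattice A) :
    ∑ Z with Z ≤ X, moebius A Z = if ambient A = X then 1 else 0 := by
  let _ : LocallyFiniteOrder (IntersectionLattice A) := Fintype.toLocallyFiniteOrder
  rw [← IncidenceAlgebra.sum_Icc_mu_right (𝕜 := ℤ) (ambient A) X]
  refine Finset.sum_congr ?_ fun _ _ => rfl
  ext Z
  rw [Finset.mem_filter, Finset.mem_Icc]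
  refine and_congr_left fun _ => iff_of_true (Finset.mem_univ _) ?_
  rw [← OrderDual.ofDual_le_ofDual]
  exact le_top (a := (OrderDual.ofDual Z).1)

open Classical in
/-- The smallest element of the intersection lattice that contains a point. -/
noncomputable def pointSpan (A : Finset (Submodule ℝ V)) (p : V) : IntersectionLattice A :=
  OrderDual.toDual ⟨(A.filter (p ∈ ·)).inf id,
    Finset.mem_image.2 ⟨_, Finset.mem_powerset.2 (Finset.filter_subset _ _), rfl⟩⟩

theorem le_pointSpan_iff (A : Finset (Submodule ℝ V)) (p : V) (Z : IntersectionLattice A) :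
    Z ≤ pointSpan A p ↔ p ∈ (OrderDual.ofDual Z).1 := by
  classical
  rw [← OrderDual.ofDual_le_ofDual]
  change (A.filter (p ∈ ·)).inf id ≤ (OrderDual.ofDual Z).1 ↔ _
  have hp : p ∈ (A.filter (p ∈ ·)).inf id := by
    rw [Submodule.mem_finsetInf]
    exact fun H hH => (Finset.mem_filter.1 hH).2
  refine ⟨fun h => h hp, fun h => ?_⟩
  obtain ⟨S, hS, hSZ⟩ := Finset.mem_image.1 (OrderDual.ofDual Z).2
  rw [← hSZ] at h ⊢
  refine Finset.inf_mono fun H hH => Finset.mem_filter.2 ⟨Finset.mem_powerset.1 hS hH, ?_⟩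
  exact (Submodule.mem_finsetInf.1 h) H hH

theorem ambient_eq_pointSpan_iff {A : Finset (Submodule ℝ V)} (hA : ⊤ ∉ A) (p : V) :
    ambient A = pointSpan A p ↔ ∀ H ∈ A, p ∉ H := by
  classical
  have h1 : ambient A = pointSpan A p ↔ (A.filter (p ∈ ·)).inf id = ⊤ := by
    rw [eq_comm, ← OrderDual.ofDual_inj, Subtype.ext_iff]
    rfl
  rw [h1, Finset.inf_eq_top_iff]
  refine ⟨fun h H hH hp => hA ?_, fun h H hH => ?_⟩
  · rw [← h H (Finset.mem_filter.2 ⟨hH, hp⟩)]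
    exact hH
  · exact absurd (Finset.mem_filter.1 hH).2 (h H (Finset.mem_filter.1 hH).1)

-- Sum over the points `φ t` the Möbius values of all `Z` containing the point. These `Z` form the
-- interval below `pointSpan A (φ t)`, so the inner sum is `1` if the point avoids `A` and `0`
-- otherwise. Exchanging the sums gives `∑ μ(Z) q ^ dim Z`.
open Classical in
theorem eval_charPoly {A : Finset (Submodule ℝ V)} (hA : ⊤ ∉ A) {T : Type*} (G : Finset T)
    (φ : T → V) (q : ℕ) (hG : ∀ Z ∈ intersections A,
      (G.filter fun t => φ t ∈ Z).card = q ^ Module.finrank ℝ Z) :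
    (charPoly A).eval (q : ℤ) = (G.filter fun t => ∀ H ∈ A, φ t ∉ H).card := by
  rw [charPoly, eval_finsetSum, Finset.card_filter]
  push_cast
  have h1 : ∀ t ∈ G, (if ∀ H ∈ A, φ t ∉ H then (1 : ℤ) else 0) =
      ∑ Z : IntersectionLattice A, if φ t ∈ (OrderDual.ofDual Z).1 then moebius A Z else 0 := by
    intro t _
    simp only [← ambient_eq_pointSpan_iff hA, ← le_pointSpan_iff A]
    rw [← sum_moebius_le, Finset.sum_filter]
  rw [Finset.sum_congr rfl h1, Finset.sum_comm]
  refine Finset.sum_congr rfl fun Z _ => ?_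
  rw [← Finset.sum_filter, Finset.sum_const, hG _ (OrderDual.ofDual Z).2, nsmul_eq_mul]
  simp [mul_comm]

end PointCount

/-! ### Subspaces cut out by equations between coordinates up to sign -/

section SignedCoordinates

variable {m : ℕ}

/-- The subspace `x i = δ x j`. -/
def signedDiagonal (i j : Fin m) (δ : ℤˣ) : Submodule ℝ (EuclideanSpace ℝ (Fin m)) where
  carrier := {x | x i = ((δ : ℤ) : ℝ) * x j}
  add_mem' {a b} ha hb := by
    simp only [Set.mem_ofPred_eq, PiLp.add_apply] at *
    rw [ha, hb, mul_add]
  zero_mem' := by simp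
  smul_mem' c a ha := by
    simp only [Set.mem_ofPred_eq, PiLp.smul_apply, smul_eq_mul] at *
    rw [ha]
    ring

theorem mem_signedDiagonal {i j : Fin m} {δ : ℤˣ} {x : EuclideanSpace ℝ (Fin m)} :
    x ∈ signedDiagonal i j δ ↔ x i = ((δ : ℤ) : ℝ) * x j := Iff.rfl

/-- On `X`, the coordinates in `J` are free, and every other coordinate is zero or up to sign a
coordinate in `J`. -/
def IsCoordinateBasis (X : Submodule ℝ (EuclideanSpace ℝ (Fin m))) (J : Finset (Fin m)) : Prop :=
  (∀ i, (∀ x ∈ X, x i = 0) ∨ ∃ j ∈ J, ∃ ε : ℤˣ, ∀ x ∈ X, x i = ((ε : ℤ) : ℝ) * x j) ∧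
    ∀ y : Fin m → ℝ, ∃ x ∈ X, ∀ j ∈ J, x j = y j

variable {X Y : Submodule ℝ (EuclideanSpace ℝ (Fin m))} {J : Finset (Fin m)}

theorem isCoordinateBasis_top :
    IsCoordinateBasis (⊤ : Submodule ℝ (EuclideanSpace ℝ (Fin m))) Finset.univ :=
  ⟨fun i => Or.inr ⟨i, Finset.mem_univ i, 1, by simp⟩, fun y => ⟨WithLp.toLp 2 y, by simp⟩⟩

theorem IsCoordinateBasis.erase_of_eq_zero (h : IsCoordinateBasis X J) {j : Fin m} (hj : j ∈ J)
    (hY : ∀ x, x ∈ Y ↔ x ∈ X ∧ x j = 0) : IsCoordinateBasis Y (J.erase j) := by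
  refine ⟨fun i => ?_, fun y => ?_⟩
  · rcases h.1 i with h0 | ⟨k, hk, ε, hε⟩
    · exact Or.inl fun x hx => h0 x ((hY x).1 hx).1
    · rcases eq_or_ne k j with rfl | hkj
      · refine Or.inl fun x hx => ?_
        rw [hε x ((hY x).1 hx).1, ((hY x).1 hx).2, mul_zero]
      · exact Or.inr ⟨k, Finset.mem_erase.2 ⟨hkj, hk⟩, ε, fun x hx => hε x ((hY x).1 hx).1⟩
  · obtain ⟨x, hx, hxy⟩ := h.2 (Function.update y j 0)
    refine ⟨x, (hY x).2 ⟨hx, by rw [hxy j hj, Function.update_self]⟩, fun k hk => ?_⟩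
    rw [Finset.mem_erase] at hk
    rw [hxy k hk.2, Function.update_of_ne hk.1]

theorem IsCoordinateBasis.erase_of_eq_mul (h : IsCoordinateBasis X J) {j k : Fin m} (hj : j ∈ J)
    (hk : k ∈ J) (hkj : k ≠ j) (η : ℤˣ) (hY : ∀ x, x ∈ Y ↔ x ∈ X ∧ x j = ((η : ℤ) : ℝ) * x k) :
    IsCoordinateBasis Y (J.erase j) := by
  refine ⟨fun i => ?_, fun y => ?_⟩
  · rcases h.1 i with h0 | ⟨l, hl, ε, hε⟩
    · exact Or.inl fun x hx => h0 x ((hY x).1 hx).1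
    · rcases eq_or_ne l j with rfl | hlj
      · refine Or.inr ⟨k, Finset.mem_erase.2 ⟨hkj, hk⟩, ε * η, fun x hx => ?_⟩
        rw [hε x ((hY x).1 hx).1, ((hY x).1 hx).2]
        push_cast
        ring
      · exact Or.inr ⟨l, Finset.mem_erase.2 ⟨hlj, hl⟩, ε, fun x hx => hε x ((hY x).1 hx).1⟩
  · obtain ⟨x, hx, hxy⟩ := h.2 (Function.update y j (((η : ℤ) : ℝ) * y k))
    refine ⟨x, (hY x).2 ⟨hx, ?_⟩, fun l hl => ?_⟩
    · rw [hxy j hj, hxy k hk, Function.update_self, Function.update_of_ne hkj]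
    · rw [Finset.mem_erase] at hl
      rw [hxy l hl.2, Function.update_of_ne hl.1]

theorem units_cast_mul_self (ε : ℤˣ) : ((ε : ℤ) : ℝ) * ((ε : ℤ) : ℝ) = 1 := by
  rw [← Int.cast_mul, Int.units_coe_mul_self, Int.cast_one]

theorem units_cast_ne_zero (ε : ℤˣ) : ((ε : ℤ) : ℝ) ≠ 0 := by
  intro h
  simpa [h] using units_cast_mul_self ε

theorem units_cast_mul_eq_iff (ε : ℤˣ) {a b : ℝ} :
    ((ε : ℤ) : ℝ) * a = b ↔ a = ((ε : ℤ) : ℝ) * b := by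
  have h := units_cast_mul_self ε
  constructor
  · rintro rfl
    rw [← mul_assoc, h, one_mul]
  · rintro rfl
    rw [← mul_assoc, h, one_mul]

/-- In terms of the free coordinates the new equation is vacuous, kills one of them, or expresses
one through another up to sign. -/
theorem IsCoordinateBasis.exists_inf_signedDiagonal (h : IsCoordinateBasis X J) (a b : Fin m)
    (δ : ℤˣ) : ∃ J', IsCoordinateBasis (signedDiagonal a b δ ⊓ X) J' := by
  have hmem : ∀ x, x ∈ signedDiagonal a b δ ⊓ X ↔ x ∈ X ∧ x a = ((δ : ℤ) : ℝ) * x b := by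
    intro x
    rw [Submodule.mem_inf, mem_signedDiagonal, and_comm]
  have hsame : (∀ x ∈ X, x a = ((δ : ℤ) : ℝ) * x b) →
      ∃ J', IsCoordinateBasis (signedDiagonal a b δ ⊓ X) J' := by
    intro h'
    refine ⟨J, ?_⟩
    rwa [inf_eq_right.2 fun x hx => mem_signedDiagonal.2 (h' x hx)]
  rcases h.1 a with ha | ⟨j, hj, ε, hε⟩
  · rcases h.1 b with hb | ⟨k, hk, η, hη⟩
    · exact hsame fun x hx => by rw [ha x hx, hb x hx, mul_zero]
    · refine ⟨_, h.erase_of_eq_zero hk fun x => (hmem x).trans (and_congr_right fun hx => ?_)⟩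
      rw [ha x hx, hη x hx, eq_comm, mul_eq_zero, mul_eq_zero,
        or_iff_right (units_cast_ne_zero δ), or_iff_right (units_cast_ne_zero η)]
  · rcases h.1 b with hb | ⟨k, hk, η, hη⟩
    · refine ⟨_, h.erase_of_eq_zero hj fun x => (hmem x).trans (and_congr_right fun hx => ?_)⟩
      rw [hε x hx, hb x hx, mul_zero, mul_eq_zero, or_iff_right (units_cast_ne_zero ε)]
    · have heq : ∀ x ∈ X, (x a = ((δ : ℤ) : ℝ) * x b ↔
          x j = (((ε * (δ * η) : ℤˣ) : ℤ) : ℝ) * x k) := by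
        intro x hx
        rw [hε x hx, hη x hx, units_cast_mul_eq_iff]
        push_cast
        rw [mul_assoc, mul_assoc]
      rcases eq_or_ne k j with rfl | hkj
      · rcases Int.units_eq_one_or (ε * (δ * η)) with h1 | h1
        · refine hsame fun x hx => (heq x hx).2 ?_
          rw [h1]
          simp
        · refine ⟨_, h.erase_of_eq_zero hj fun x =>
            (hmem x).trans (and_congr_right fun hx => (heq x hx).trans ?_)⟩
          rw [h1]
          simp only [Units.val_neg, Units.val_one, Int.cast_neg, Int.cast_one, neg_mul, one_mul]
          exact self_eq_neg
      · exact ⟨_, h.erase_of_eq_mul hj hk hkj (ε * (δ * η)) fun x =>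
          (hmem x).trans (and_congr_right fun hx => heq x hx)⟩

theorem exists_isCoordinateBasis {A : Finset (Submodule ℝ (EuclideanSpace ℝ (Fin m)))}
    (hA : ∀ H ∈ A, ∃ i j δ, H = signedDiagonal i j δ) (hX : X ∈ intersections A) :
    ∃ J, IsCoordinateBasis X J := by
  classical
  obtain ⟨S, hS, rfl⟩ := Finset.mem_image.1 hX
  replace hS := Finset.mem_powerset.1 hS
  clear hX
  induction S using Finset.induction_on with
  | empty => exact ⟨_, by simpa using isCoordinateBasis_top⟩
  | insert H S _ ih =>
    obtain ⟨J, hJ⟩ := ih fun K hK => hS (Finset.mem_insert_of_mem hK)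
    obtain ⟨i, j, δ, hH⟩ := hA H (hS (Finset.mem_insert_self H S))
    rw [Finset.inf_insert, id, hH]
    exact hJ.exists_inf_signedDiagonal i j δ

theorem IsCoordinateBasis.eq_of_eqOn (h : IsCoordinateBasis X J)
    {x y : EuclideanSpace ℝ (Fin m)} (hx : x ∈ X) (hy : y ∈ X) (hxy : ∀ j ∈ J, x j = y j) :
    x = y := by
  ext i
  rcases h.1 i with h0 | ⟨j, hj, ε, hε⟩
  · rw [h0 x hx, h0 y hy]
  · rw [hε x hx, hε y hy, hxy j hj]

theorem IsCoordinateBasis.finrank_eq (h : IsCoordinateBasis X J) :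
    Module.finrank ℝ X = J.card := by
  let f : X →ₗ[ℝ] (J → ℝ) :=
    { toFun := fun x j => x.1 j
      map_add' := fun x y => by ext; simp
      map_smul' := fun c x => by ext; simp }
  have hf : Function.Bijective f := by
    constructor
    · intro x y hxy
      exact Subtype.ext (h.eq_of_eqOn x.2 y.2 fun j hj => congrFun hxy ⟨j, hj⟩)
    · intro y
      obtain ⟨x, hx, hxy⟩ := h.2 fun i => if hi : i ∈ J then y ⟨i, hi⟩ else 0
      refine ⟨⟨x, hx⟩, funext fun j => ?_⟩
      have := hxy j j.2
      rw [dif_pos j.2] at this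
      exact this
  rw [(LinearEquiv.ofBijective f hf).finrank_eq, Module.finrank_fintype_fun_eq_card,
    Fintype.card_coe]

/-- The point with the given integral coordinates. -/
noncomputable def latticePoint (f : Fin m → ℤ) : EuclideanSpace ℝ (Fin m) :=
  WithLp.toLp 2 fun i => (f i : ℝ)

@[simp]
theorem latticePoint_apply (f : Fin m → ℤ) (i : Fin m) : latticePoint f i = f i := rfl

/-- The integral points of a cube. -/
noncomputable def cube (m s : ℕ) : Finset (Fin m → ℤ) := Fintype.piFinset fun _ => Finset.Icc (-s : ℤ) s

theorem mem_cube {s : ℕ} {f : Fin m → ℤ} : f ∈ cube m s ↔ ∀ i, f i ∈ Finset.Icc (-s : ℤ) s :=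
  Fintype.mem_piFinset

-- The interval `[-s, s]` contains `0` and is symmetric, so free coordinates chosen in it keep all
-- other coordinates in it.
open Classical in
theorem IsCoordinateBasis.card_cube (h : IsCoordinateBasis X J) (s : ℕ) :
    ((cube m s).filter fun f => latticePoint f ∈ X).card =
      (2 * s + 1) ^ Module.finrank ℝ X := by
  have hcard : (Fintype.piFinset fun _ : J => Finset.Icc (-s : ℤ) s).card =
      (2 * s + 1) ^ J.card := by
    rw [Fintype.card_piFinset, Finset.prod_const, Int.card_Icc, Finset.card_univ, Fintype.card_coe]
    congr 1
    omega
  rw [h.finrank_eq, ← hcard]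
  refine Finset.card_bij (fun f _ j => f j) ?_ ?_ ?_
  · intro f hf
    exact Fintype.mem_piFinset.2 fun j => mem_cube.1 (Finset.mem_filter.1 hf).1 j
  · intro f hf g hg hfg
    have := h.eq_of_eqOn (Finset.mem_filter.1 hf).2 (Finset.mem_filter.1 hg).2
      fun j hj => by simpa using congrFun hfg ⟨j, hj⟩
    funext i
    simpa using congrArg (fun x : EuclideanSpace ℝ (Fin m) => x i) this
  · intro g hg
    rw [Fintype.mem_piFinset] at hg
    obtain ⟨x, hx, hxy⟩ := h.2 fun i => if hi : i ∈ J then (g ⟨i, hi⟩ : ℝ) else 0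
    have hint : ∀ i, ∃ n ∈ Finset.Icc (-s : ℤ) s, (n : ℝ) = x i := by
      intro i
      rcases h.1 i with h0 | ⟨j, hj, ε, hε⟩
      · exact ⟨0, by simp, by rw [h0 x hx, Int.cast_zero]⟩
      · have hj' := hxy j hj
        rw [dif_pos hj] at hj'
        refine ⟨ε * g ⟨j, hj⟩, ?_, by rw [hε x hx, hj', Int.cast_mul]⟩
        have := Finset.mem_Icc.1 (hg ⟨j, hj⟩)
        rcases Int.units_eq_one_or ε with rfl | rfl
        · simpa using this
        · rw [Finset.mem_Icc]
          simp only [Units.val_neg, Units.val_one, neg_mul, one_mul]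
          omega
    choose f hf hfx using hint
    have hfx' : latticePoint f = x := by
      ext i
      exact hfx i
    refine ⟨f, Finset.mem_filter.2 ⟨mem_cube.2 hf, by rwa [hfx']⟩, funext fun j => ?_⟩
    have := hxy j j.2
    rw [dif_pos j.2, ← hfx] at this
    exact Int.cast_injective (α := ℝ) this

end SignedCoordinates

/-! ### Signed permutations and their mirrors -/

section Mirrors

/-- For an isometric involution, `(v + g v) / 2` is the orthogonal projection of `v` to the fixed
space. -/
theorem reflection_eq_of_involutive {V : Type*} [NormedAddCommGroup V] [InnerProductSpace ℝ V]
    [FiniteDimensional ℝ V] {g : V ≃ₗᵢ[ℝ] V} (hg : ∀ v, g (g v) = v) {H : Submodule ℝ V}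
    (hH : ∀ v, v ∈ H ↔ g v = v) : H.reflection = g := by
  ext v
  have h1 : (H.starProjection v : V) = (1 / 2 : ℝ) • (v + g v) := by
    refine Submodule.eq_starProjection_of_mem_of_inner_eq_zero ?_ fun u hu => ?_
    · rw [hH, map_smul, map_add, hg, add_comm]
    · have h2 : v - (1 / 2 : ℝ) • (v + g v) = (1 / 2 : ℝ) • (v - g v) := by module
      rw [h2, inner_smul_left, inner_sub_left]
      have h3 := g.inner_map_map v u
      rw [(hH u).1 hu] at h3
      rw [h3, sub_self, mul_zero]
  rw [Submodule.reflection_apply, h1]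
  module

variable {m : ℕ}

/-- The isometry that permutes the coordinates by `σ` and changes their signs by `s`. -/
noncomputable def signedPerm (s : Fin m → ℤˣ) (σ : Equiv.Perm (Fin m)) :
    EuclideanSpace ℝ (Fin m) ≃ₗᵢ[ℝ] EuclideanSpace ℝ (Fin m) where
  toFun x := WithLp.toLp 2 fun i => ((s i : ℤ) : ℝ) * x (σ i)
  invFun x := WithLp.toLp 2 fun i => ((s (σ.symm i) : ℤ) : ℝ) * x (σ.symm i)
  map_add' x y := by
    ext i
    simp [mul_add]
  map_smul' c x := by
    ext i
    simp only [PiLp.smul_apply, smul_eq_mul, RingHom.id_apply]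
    ring
  left_inv x := by
    ext i
    simp [← mul_assoc, units_cast_mul_self]
  right_inv x := by
    ext i
    simp [← mul_assoc, units_cast_mul_self]
  norm_map' x := by
    have h : ∀ i, ‖((s i : ℤ) : ℝ) * x (σ i)‖ ^ 2 = ‖x (σ i)‖ ^ 2 := by
      intro i
      rw [Real.norm_eq_abs, Real.norm_eq_abs, sq_abs, sq_abs, mul_pow, sq ((s i : ℤ) : ℝ),
        units_cast_mul_self, one_mul]
    rw [EuclideanSpace.norm_eq, EuclideanSpace.norm_eq, ← Equiv.sum_comp σ fun i => ‖x i‖ ^ 2,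
      ← Finset.sum_congr rfl fun i _ => h i]
    rfl

@[simp]
theorem signedPerm_apply (s : Fin m → ℤˣ) (σ : Equiv.Perm (Fin m))
    (x : EuclideanSpace ℝ (Fin m)) (i : Fin m) :
    signedPerm s σ x i = ((s i : ℤ) : ℝ) * x (σ i) := rfl

theorem mem_groupB {g : EuclideanSpace ℝ (Fin m) ≃ₗᵢ[ℝ] EuclideanSpace ℝ (Fin m)} :
    g ∈ groupB m ↔ ∃ s σ, signedPerm s σ = g := by
  constructor
  · rintro ⟨σ, s, h⟩
    refine ⟨s, σ, ?_⟩
    ext x i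
    rw [h, signedPerm_apply]
  · rintro ⟨s, σ, rfl⟩
    exact ⟨σ, s, fun x i => rfl⟩

theorem mem_permGroup {g : EuclideanSpace ℝ (Fin m) ≃ₗᵢ[ℝ] EuclideanSpace ℝ (Fin m)} :
    g ∈ permGroup m ↔ ∃ σ, signedPerm 1 σ = g := by
  constructor
  · rintro ⟨σ, h⟩
    refine ⟨σ, ?_⟩
    ext x i
    rw [h, signedPerm_apply]
    simp
  · rintro ⟨σ, rfl⟩
    exact ⟨σ, fun x i => by simp⟩

theorem abs_units_cast (ε : ℤˣ) : |((ε : ℤ) : ℝ)| = 1 := by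
  rcases Int.units_eq_one_or ε with rfl | rfl <;> simp

theorem signedPerm_injective {s t : Fin m → ℤˣ} {σ τ : Equiv.Perm (Fin m)}
    (h : signedPerm s σ = signedPerm t τ) : s = t ∧ σ = τ := by
  -- Evaluate at the vector `(1, …, m)`, whose coordinates are nonzero with distinct absolute
  -- values.
  have h1 : ∀ i, ((s i : ℤ) : ℝ) * ((σ i : ℕ) + 1 : ℝ) = ((t i : ℤ) : ℝ) * ((τ i : ℕ) + 1) := by
    intro i
    exact congrArg (fun g : EuclideanSpace ℝ (Fin m) ≃ₗᵢ[ℝ] EuclideanSpace ℝ (Fin m) =>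
      g (WithLp.toLp 2 fun j : Fin m => ((j : ℕ) + 1 : ℝ)) i) h
  have h2 : σ = τ := by
    ext i
    have := congrArg abs (h1 i)
    rw [abs_mul, abs_mul, abs_units_cast, abs_units_cast, one_mul, one_mul,
      abs_of_nonneg (by positivity), abs_of_nonneg (by positivity)] at this
    exact_mod_cast add_right_cancel this
  subst h2
  refine ⟨funext fun i => ?_, rfl⟩
  have h3 := mul_right_cancel₀ (by positivity) (h1 i)
  exact Units.ext (Int.cast_injective h3)

/-- The hypothesis excludes the trivial equation `x i = x i`; the case `i = j`, `δ = -1` is the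
coordinate hyperplane `x i = 0`. -/
theorem finrank_signedDiagonal_add_one {i j : Fin m} {δ : ℤˣ} (h : i ≠ j ∨ δ = -1) :
    Module.finrank ℝ (signedDiagonal i j δ) + 1 = m := by
  have h1 : IsCoordinateBasis (signedDiagonal i j δ) (Finset.univ.erase i) := by
    rcases eq_or_ne i j with rfl | hij
    · have hδ := h.resolve_left (not_not.2 rfl)
      refine isCoordinateBasis_top.erase_of_eq_zero (Finset.mem_univ i) fun x => ?_
      rw [mem_signedDiagonal, hδ]
      simp [self_eq_neg]
    · refine isCoordinateBasis_top.erase_of_eq_mul (Finset.mem_univ i) (Finset.mem_univ j)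
        hij.symm δ fun x => ?_
      simp [mem_signedDiagonal]
  rw [h1.finrank_eq, Finset.card_erase_add_one (Finset.mem_univ i), Finset.card_univ,
    Fintype.card_fin]

theorem reflection_signedDiagonal (i j : Fin m) (δ : ℤˣ) (h : i ≠ j ∨ δ = -1) :
    (signedDiagonal i j δ).reflection =
      signedPerm (fun k => if k = i ∨ k = j then δ else 1) (Equiv.swap i j) := by
  refine reflection_eq_of_involutive (fun v => ?_) fun v => ?_
  · ext k
    rw [signedPerm_apply, signedPerm_apply, Equiv.swap_apply_self, ← mul_assoc]
    by_cases hk : k = i ∨ k = j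
    · have hk' : Equiv.swap i j k = i ∨ Equiv.swap i j k = j := by
        rcases hk with rfl | rfl <;> simp
      rw [if_pos hk, if_pos hk', units_cast_mul_self, one_mul]
    · have hk' : Equiv.swap i j k = k :=
        Equiv.swap_apply_of_ne_of_ne (fun h => hk (Or.inl h)) fun h => hk (Or.inr h)
      rw [hk', if_neg hk]
      simp
  · rw [mem_signedDiagonal]
    constructor
    · intro hv
      ext k
      rw [signedPerm_apply]
      by_cases hi : k = i
      · subst hi
        simpa using hv.symm
      by_cases hj : k = j
      · subst hj
        rw [if_pos (Or.inr rfl), Equiv.swap_apply_right, units_cast_mul_eq_iff]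
        exact hv
      · rw [if_neg (by tauto), Equiv.swap_apply_of_ne_of_ne hi hj]
        simp
    · intro hv
      have := congrArg (fun x : EuclideanSpace ℝ (Fin m) => x i) hv
      simpa using this.symm

/-- Points of the mirror are fixed, so they satisfy `x i = s i * x (σ i)` for all `i`. A single
nontrivial one of these equations already cuts out a hyperplane, which equals `H` by dimension. -/
theorem mirror_eq_signedDiagonal {H : Submodule ℝ (EuclideanSpace ℝ (Fin m))}
    {s : Fin m → ℤˣ} {σ : Equiv.Perm (Fin m)}
    (hH : Module.finrank ℝ H + 1 = Module.finrank ℝ (EuclideanSpace ℝ (Fin m)))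
    (hr : H.reflection = signedPerm s σ) :
    ∃ i, (i ≠ σ i ∨ s i = -1) ∧ H = signedDiagonal i (σ i) (s i) := by
  have hmem : ∀ x ∈ H, ∀ i, x i = ((s i : ℤ) : ℝ) * x (σ i) := by
    intro x hx i
    rw [← signedPerm_apply, ← hr, Submodule.reflection_eq_self_iff x |>.2 hx]
  obtain ⟨i, hi⟩ : ∃ i, i ≠ σ i ∨ s i = -1 := by
    by_contra! hcon
    have hs : ∀ i, s i = 1 := fun i => (Int.units_eq_one_or (s i)).resolve_right (hcon i).2
    have htop : H = ⊤ := by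
      refine Submodule.eq_top_iff'.2 fun x => ?_
      rw [← Submodule.reflection_eq_self_iff, hr]
      ext i
      rw [signedPerm_apply, hs i, ← (hcon i).1]
      simp
    rw [htop, finrank_top] at hH
    omega
  refine ⟨i, hi, Submodule.eq_of_le_of_finrank_eq (fun x hx => hmem x hx i) ?_⟩
  have := finrank_signedDiagonal_add_one hi
  rw [finrank_euclideanSpace_fin] at hH
  omega

theorem mem_reflectionArrangement_groupB {H : Submodule ℝ (EuclideanSpace ℝ (Fin m))} :
    H ∈ reflectionArrangement (groupB m) ↔
      ∃ i j δ, (i ≠ j ∨ δ = -1) ∧ H = signedDiagonal i j δ := by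
  rw [reflectionArrangement, Set.Finite.mem_toFinset, mirrors, Set.mem_ofPred_eq]
  constructor
  · rintro ⟨hH, hr⟩
    obtain ⟨s, σ, hg⟩ := mem_groupB.1 hr
    obtain ⟨i, hi, h⟩ := mirror_eq_signedDiagonal hH hg.symm
    exact ⟨i, σ i, s i, hi, h⟩
  · rintro ⟨i, j, δ, h, rfl⟩
    refine ⟨?_, ?_⟩
    · rw [finrank_euclideanSpace_fin, finrank_signedDiagonal_add_one h]
    · rw [reflection_signedDiagonal i j δ h]
      exact mem_groupB.2 ⟨_, _, rfl⟩

theorem mem_reflectionArrangement_permGroup {H : Submodule ℝ (EuclideanSpace ℝ (Fin m))} :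
    H ∈ reflectionArrangement (permGroup m) ↔ ∃ i j, i ≠ j ∧ H = signedDiagonal i j 1 := by
  rw [reflectionArrangement, Set.Finite.mem_toFinset, mirrors, Set.mem_ofPred_eq]
  constructor
  · rintro ⟨hH, hr⟩
    obtain ⟨σ, hg⟩ := mem_permGroup.1 hr
    obtain ⟨i, hi, h⟩ := mirror_eq_signedDiagonal hH hg.symm
    refine ⟨i, σ i, hi.resolve_right fun h => ?_, h⟩
    exact absurd h (by rw [Pi.one_apply]; decide)
  · rintro ⟨i, j, h, rfl⟩
    refine ⟨?_, ?_⟩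
    · rw [finrank_euclideanSpace_fin, finrank_signedDiagonal_add_one (Or.inl h)]
    · rw [reflection_signedDiagonal i j 1 (Or.inl h)]
      refine mem_permGroup.2 ⟨Equiv.swap i j, ?_⟩
      congr 1
      funext k
      simp

theorem top_notMem_reflectionArrangement {V : Type*} [NormedAddCommGroup V]
    [InnerProductSpace ℝ V] [FiniteDimensional ℝ V] (W : Subgroup (V ≃ₗᵢ[ℝ] V)) [Finite W] :
    ⊤ ∉ reflectionArrangement W := by
  rw [reflectionArrangement, Set.Finite.mem_toFinset]
  rintro ⟨h, -⟩
  rw [finrank_top] at h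
  omega

end Mirrors

/-! ### The characteristic polynomials of types A and B -/

section CharPoly

variable {m : ℕ}

/-- Only large `s` are required, so that the subtractions in the descending factorials below are not
truncated. -/
theorem eq_of_eval_odd_eq {p q : ℤ[X]}
    (h : ∀ s : ℕ, m ≤ s → p.eval ((2 * s + 1 : ℕ) : ℤ) = q.eval ((2 * s + 1 : ℕ) : ℤ)) :
    p = q := by
  refine eq_of_infinite_eval_eq p q ?_
  have hinj : Function.Injective fun s : ℕ => ((2 * (m + s) + 1 : ℕ) : ℤ) := by
    intro a b hab
    simp only [Nat.cast_inj] at hab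
    omega
  refine (Set.infinite_range_of_injective hinj).mono ?_
  rintro _ ⟨s, rfl⟩
  exact h (m + s) (Nat.le_add_right m s)

theorem card_cube_injective (s : ℕ) :
    ((cube m s).filter fun f => Function.Injective f).card = (2 * s + 1).descFactorial m := by
  have h : Fintype.card (Fin m ↪ Finset.Icc (-s : ℤ) s) = (2 * s + 1).descFactorial m := by
    rw [Fintype.card_embedding_eq, Fintype.card_coe, Int.card_Icc, Fintype.card_fin]
    congr 1
    omega
  rw [← h, ← Finset.card_univ]
  symm
  refine Finset.card_bij (fun e _ i => (e i : ℤ)) ?_ ?_ ?_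
  · intro e _
    exact Finset.mem_filter.2 ⟨mem_cube.2 fun i => (e i).2,
      Subtype.val_injective.comp e.injective⟩
  · intro e _ e' _ h
    ext i
    exact congrFun h i
  · intro f hf
    obtain ⟨h1, h2⟩ := Finset.mem_filter.1 hf
    exact ⟨⟨fun i => ⟨f i, mem_cube.1 h1 i⟩, fun i j hij => h2 (congrArg Subtype.val hij)⟩,
      Finset.mem_univ _, rfl⟩

-- Off the mirrors, `f` has nonzero values with distinct absolute values, so it is an arbitrary
-- choice of signs times an injection into `{1, …, s}`.
open Classical in
theorem card_cube_signed_injective (s : ℕ) :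
    ((cube m s).filter fun f => ∀ i j, ∀ δ : ℤˣ, (i ≠ j ∨ δ = -1) → f i ≠ (δ : ℤ) * f j).card =
      2 ^ m * s.descFactorial m := by
  have h : Fintype.card ((Fin m → ℤˣ) × (Fin m ↪ Finset.Icc (1 : ℤ) s)) =
      2 ^ m * s.descFactorial m := by
    rw [Fintype.card_prod, Fintype.card_embedding_eq, Fintype.card_coe, Int.card_Icc,
      Fintype.card_fin, Fintype.card_fun, Fintype.card_fin, Fintype.card_units_int]
    congr 2
    omega
  have habs : ∀ ε : ℤˣ, |(ε : ℤ)| = 1 := fun ε => Int.isUnit_iff_abs_eq.1 ε.isUnit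
  rw [← h, ← Finset.card_univ]
  symm
  refine Finset.card_bij (fun e _ i => (e.1 i : ℤ) * (e.2 i : ℤ)) ?_ ?_ ?_
  · rintro ⟨ε, e⟩ _
    have hpos : ∀ i, 1 ≤ (e i : ℤ) ∧ (e i : ℤ) ≤ s := fun i => Finset.mem_Icc.1 (e i).2
    refine Finset.mem_filter.2 ⟨mem_cube.2 fun i => ?_, fun i j δ hij heq => ?_⟩
    · dsimp only
      have := hpos i
      rw [Finset.mem_Icc, ← abs_le, abs_mul, habs, one_mul, abs_of_nonneg (by omega)]
      exact this.2
    · dsimp only at heq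
      have h1 := congrArg abs heq
      rw [abs_mul, abs_mul, abs_mul, habs, habs, habs, one_mul, one_mul, one_mul,
        abs_of_nonneg (by linarith [(hpos i).1]), abs_of_nonneg (by linarith [(hpos j).1])] at h1
      have h2 : i = j := e.injective (Subtype.ext h1)
      subst h2
      have h3 := hij.resolve_left (not_not.2 rfl)
      subst h3
      simp only [Units.val_neg, Units.val_one, neg_mul, one_mul, self_eq_neg, mul_eq_zero,
        Units.ne_zero, false_or] at heq
      linarith [(hpos i).1]
  · rintro ⟨ε, e⟩ _ ⟨ε', e'⟩ _ heq
    have hpos : ∀ i, 0 < (e i : ℤ) := fun i => (Finset.mem_Icc.1 (e i).2).1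
    have hpos' : ∀ i, 0 < (e' i : ℤ) := fun i => (Finset.mem_Icc.1 (e' i).2).1
    have h1 : ∀ i, (e i : ℤ) = e' i := by
      intro i
      have := congrArg abs (congrFun heq i)
      dsimp only at this
      rwa [abs_mul, abs_mul, habs, habs, one_mul, one_mul, abs_of_pos (hpos i),
        abs_of_pos (hpos' i)] at this
    have h2 : ε = ε' := by
      funext i
      have := congrFun heq i
      dsimp only at this
      rw [h1 i] at this
      exact Units.ext (mul_right_cancel₀ (hpos' i).ne' this)
    exact Prod.ext h2 (DFunLike.ext _ _ fun i => Subtype.ext (h1 i))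
  · intro f hf
    obtain ⟨h1, h2⟩ := Finset.mem_filter.1 hf
    have h0 : ∀ i, f i ≠ 0 := by
      intro i hi
      exact h2 i i (-1) (Or.inr rfl) (by simp [hi])
    have hsign : ∀ i, ∃ ε : ℤˣ, f i = ε * |f i| := by
      intro i
      rcases (h0 i).lt_or_gt with h | h
      · exact ⟨-1, by simp [abs_of_neg h]⟩
      · exact ⟨1, by simp [abs_of_pos h]⟩
    choose ε hε using hsign
    have hmem : ∀ i, |f i| ∈ Finset.Icc (1 : ℤ) s := by
      intro i
      rw [Finset.mem_Icc]
      exact ⟨Int.one_le_abs (h0 i), abs_le.2 (Finset.mem_Icc.1 (mem_cube.1 h1 i))⟩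
    have hinj : Function.Injective fun i => (⟨|f i|, hmem i⟩ : Finset.Icc (1 : ℤ) s) := by
      intro i j hij
      by_contra hne
      have h3 : |f i| = |f j| := congrArg Subtype.val hij
      rcases abs_eq_abs.1 h3 with h4 | h4
      · exact h2 i j 1 (Or.inl hne) (by simpa using h4)
      · exact h2 i j (-1) (Or.inl hne) (by simpa using h4)
    exact ⟨⟨ε, ⟨_, hinj⟩⟩, Finset.mem_univ _, funext fun i => (hε i).symm⟩

theorem latticePoint_mem_signedDiagonal {f : Fin m → ℤ} {i j : Fin m} {δ : ℤˣ} :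
    latticePoint f ∈ signedDiagonal i j δ ↔ f i = δ * f j := by
  rw [mem_signedDiagonal, latticePoint_apply, latticePoint_apply, ← Int.cast_mul, Int.cast_inj]

theorem charPoly_permGroup (m : ℕ) : charPoly (reflectionArrangement (permGroup m)) =
    ∏ j ∈ Finset.range m, (X - C (j : ℤ)) := by
  classical
  refine eq_of_eval_odd_eq (m := m) fun s hs => ?_
  rw [eval_charPoly (top_notMem_reflectionArrangement _) (cube m s) latticePoint]
  · have h1 : ((cube m s).filter fun f => ∀ H ∈ reflectionArrangement (permGroup m),
        latticePoint f ∉ H) = (cube m s).filter fun f => Function.Injective f := by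
      refine Finset.filter_congr fun f _ => ?_
      constructor
      · intro h i j hij
        by_contra hne
        refine h _ (mem_reflectionArrangement_permGroup.2 ⟨i, j, hne, rfl⟩) ?_
        rw [latticePoint_mem_signedDiagonal, hij, Units.val_one, one_mul]
      · intro h H hH hfH
        obtain ⟨i, j, hij, rfl⟩ := mem_reflectionArrangement_permGroup.1 hH
        rw [latticePoint_mem_signedDiagonal, Units.val_one, one_mul] at hfH
        exact hij (h hfH)
    rw [h1, card_cube_injective, Nat.descFactorial_eq_prod_range, eval_prod]
    push_cast
    refine Finset.prod_congr rfl fun j hj => ?_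
    have := Finset.mem_range.1 hj
    rw [Nat.cast_sub (by omega)]
    simp
  · intro Z hZ
    obtain ⟨J, hJ⟩ := exists_isCoordinateBasis (fun H hH => by
      obtain ⟨i, j, -, rfl⟩ := mem_reflectionArrangement_permGroup.1 hH
      exact ⟨i, j, 1, rfl⟩) hZ
    exact hJ.card_cube s

theorem charPoly_groupB (m : ℕ) : charPoly (reflectionArrangement (groupB m)) =
    ∏ j ∈ Finset.range m, (X - C (2 * (j : ℤ) + 1)) := by
  classical
  refine eq_of_eval_odd_eq (m := m) fun s hs => ?_
  rw [eval_charPoly (top_notMem_reflectionArrangement _) (cube m s) latticePoint]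
  · have h1 : ((cube m s).filter fun f => ∀ H ∈ reflectionArrangement (groupB m),
        latticePoint f ∉ H) = (cube m s).filter fun f => ∀ i j, ∀ δ : ℤˣ,
          (i ≠ j ∨ δ = -1) → f i ≠ (δ : ℤ) * f j := by
      refine Finset.filter_congr fun f _ => ?_
      constructor
      · intro h i j δ hij heq
        exact h _ (mem_reflectionArrangement_groupB.2 ⟨i, j, δ, hij, rfl⟩)
          (latticePoint_mem_signedDiagonal.2 heq)
      · intro h H hH hfH
        obtain ⟨i, j, δ, hij, rfl⟩ := mem_reflectionArrangement_groupB.1 hH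
        exact h i j δ hij (latticePoint_mem_signedDiagonal.1 hfH)
    rw [h1, card_cube_signed_injective, Nat.descFactorial_eq_prod_range, eval_prod]
    -- Each factor matches as `2 (s - j) = (2 s + 1) - (2 j + 1)`.
    have h2 : 2 ^ m = ∏ i ∈ Finset.range m, 2 := by simp
    rw [h2, ← Finset.prod_mul_distrib]
    push_cast
    refine Finset.prod_congr rfl fun j hj => ?_
    have := Finset.mem_range.1 hj
    rw [Nat.cast_sub (by omega)]
    simp only [eval_sub, eval_X, eval_C]
    ring
  · intro Z hZ
    obtain ⟨J, hJ⟩ := exists_isCoordinateBasis (fun H hH => by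
      obtain ⟨i, j, δ, -, rfl⟩ := mem_reflectionArrangement_groupB.1 hH
      exact ⟨i, j, δ, rfl⟩) hZ
    exact hJ.card_cube s

end CharPoly

/-! ### Generic points -/

section Generic

variable {V : Type*} [NormedAddCommGroup V] [InnerProductSpace ℝ V] {K : Set V}

theorem ForGeneric.mono {P Q : V → Prop} (h : ForGeneric K P) (hPQ : ∀ x, P x → Q x) :
    ForGeneric K Q := by
  obtain ⟨N, hN, h⟩ := h
  exact ⟨N, hN, fun x hx hxN => hPQ x (h x hx hxN)⟩

theorem forGeneric_of_forall {P : V → Prop} (h : ∀ x, P x) : ForGeneric K P :=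
  ⟨∅, by simp, fun x _ _ => h x⟩

theorem forGeneric_forall {α : Type*} [Finite α] {P : α → V → Prop}
    (h : ∀ a, ForGeneric K (P a)) : ForGeneric K fun x => ∀ a, P a x := by
  classical
  have := Fintype.ofFinite α
  choose N hN h using h
  refine ⟨Finset.univ.biUnion N, fun H hH => ?_, fun x hx hxN a => h a x hx fun H hH => ?_⟩
  · obtain ⟨a, -, ha⟩ := Finset.mem_biUnion.1 hH
    exact hN a H ha
  · exact hxN H (Finset.mem_biUnion.2 ⟨a, Finset.mem_univ a, hH⟩)

theorem ForGeneric.and {P Q : V → Prop} (hP : ForGeneric K P) (hQ : ForGeneric K Q) :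
    ForGeneric K fun x => P x ∧ Q x :=
  (forGeneric_forall (P := fun b : Bool => if b then P else Q)
    (fun b => by cases b <;> simpa)).mono fun x h => ⟨by simpa using h true, by simpa using h false⟩

theorem forGeneric_imp {p : Prop} {P : V → Prop} (h : p → ForGeneric K P) :
    ForGeneric K fun x => p → P x := by
  by_cases hp : p
  · exact (h hp).mono fun x hx _ => hx
  · exact forGeneric_of_forall fun x h => absurd h hp

variable {m : ℕ}

theorem forGeneric_sum_mul_ne_zero {K : Set (EuclideanSpace ℝ (Fin m))} {c : Fin m → ℝ}
    {i : Fin m} (hi : c i ≠ 0) : ForGeneric K fun x => ∑ j, c j * x j ≠ 0 := by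
  let f : EuclideanSpace ℝ (Fin m) →ₗ[ℝ] ℝ :=
    { toFun := fun x => ∑ j, c j * x j
      map_add' := fun x y => by simp [mul_add, Finset.sum_add_distrib]
      map_smul' := fun a x => by
        simp only [PiLp.smul_apply, smul_eq_mul, RingHom.id_apply, Finset.mul_sum]
        exact Finset.sum_congr rfl fun j _ => by ring }
  refine ⟨{LinearMap.ker f}, ?_, fun x _ hx => ?_⟩
  · intro H hH htop
    rw [Finset.mem_singleton.1 hH, LinearMap.ker_eq_top] at htop
    have : f (EuclideanSpace.single i 1) = c i := by
      simp [f]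
    rw [htop, LinearMap.zero_apply] at this
    exact hi this.symm
  · exact hx _ (Finset.mem_singleton_self _)

/-- Cross-multiplied, equality of two means is a linear equation in `x`, and it depends only on the
sets of letters. On a finite index type this leaves finitely many equations. -/
theorem isGenericValues_of_finset {ι : Type*} [DecidableEq ι] {w x : ι → ℝ} (hw : ∀ i, 0 < w i)
    (h : ∀ P Q : Finset ι, P.Nonempty → Q.Nonempty → Disjoint P Q →
      (∑ i ∈ Q, w i) * (∑ i ∈ P, w i * x i) - (∑ i ∈ P, w i) * (∑ i ∈ Q, w i * x i) ≠ 0) :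
    IsGenericValues w x := by
  intro p q hp hq hpq heq
  obtain ⟨hpn, hqn, hdis⟩ := List.nodup_append'.1 hpq
  refine h p.toFinset q.toFinset (List.toFinset_nonempty_iff p |>.2 hp)
    (List.toFinset_nonempty_iff q |>.2 hq) (List.disjoint_toFinset_iff_disjoint.2 hdis) ?_
  rw [List.sum_toFinset _ hpn, List.sum_toFinset _ hqn, List.sum_toFinset _ hpn,
    List.sum_toFinset _ hqn, sum_map_mul_eq hw hp, sum_map_mul_eq hw hq, heq]
  ring

theorem forGeneric_isGenericValues (K : Set (EuclideanSpace ℝ (Fin m))) {ω : Fin m → ℝ}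
    (hω : ∀ i, 0 < ω i) : ForGeneric K fun x =>
      (∀ e : Fin m → ℤˣ, IsGenericValues ω (signedValues e x)) ∧
      ∀ e : Fin m → ℤˣ, ∀ B : Finset (Fin m), B.Nonempty →
        ∑ i ∈ B, ω i * signedValues e x i ≠ 0 := by
  refine ForGeneric.and ?_ ?_
  · refine forGeneric_forall fun e => ?_
    refine ForGeneric.mono ?_ fun x h => isGenericValues_of_finset hω h
    refine forGeneric_forall fun P => forGeneric_forall fun Q => forGeneric_imp fun hP =>
      forGeneric_imp fun hQ => forGeneric_imp fun hPQ => ?_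
    obtain ⟨i, hi⟩ := hP
    -- The coefficients of that linear form in `x`; at `i ∈ P` only the first term is present.
    let c : Fin m → ℝ := fun j => (((e j : ℤ) : ℝ) * ω j) *
      ((if j ∈ P then ∑ i ∈ Q, ω i else 0) - if j ∈ Q then ∑ i ∈ P, ω i else 0)
    have hc : c i ≠ 0 := by
      dsimp only [c]
      rw [if_pos hi, if_neg (Finset.disjoint_left.1 hPQ hi), sub_zero]
      exact mul_ne_zero (mul_ne_zero (units_cast_ne_zero _) (hω i).ne')
        (Finset.sum_pos (fun i _ => hω i) hQ).ne'
    refine (forGeneric_sum_mul_ne_zero hc).mono fun x hx => ?_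
    convert hx using 1
    have h1 : ∀ S : Finset (Fin m), ∑ i ∈ S, ω i * signedValues e x i =
        ∑ i, if i ∈ S then ω i * signedValues e x i else 0 := fun S => by
      rw [Finset.sum_ite_mem, Finset.univ_inter]
    rw [h1, h1, Finset.mul_sum, Finset.mul_sum, ← Finset.sum_sub_distrib]
    refine Finset.sum_congr rfl fun j _ => ?_
    simp only [signedValues, c]
    split_ifs <;> ring
  · refine forGeneric_forall fun e => forGeneric_forall fun B => forGeneric_imp fun hB => ?_
    obtain ⟨i, hi⟩ := hB
    let c : Fin m → ℝ := fun j => if j ∈ B then ((e j : ℤ) : ℝ) * ω j else 0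
    have hc : c i ≠ 0 := by
      dsimp only [c]
      rw [if_pos hi]
      exact mul_ne_zero (units_cast_ne_zero _) (hω i).ne'
    refine (forGeneric_sum_mul_ne_zero hc).mono fun x hx => ?_
    convert hx using 1
    simp only [ite_mul, zero_mul, Finset.sum_ite_mem, Finset.univ_inter, signedValues, c]
    exact Finset.sum_congr rfl fun j _ => by ring

end Generic

/-! ### Chambers and their faces -/

section Chambers

variable {m : ℕ}

/-- The functionals defining the chamber of type A in which the coordinates are increasing in the
order `σ`. -/
noncomputable def permFunctional (σ : Equiv.Perm (Fin m)) (p : {p : Fin m × Fin m // p.1 < p.2}) :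
    EuclideanSpace ℝ (Fin m) →L[ℝ] ℝ :=
  EuclideanSpace.proj (σ p.1.2) - EuclideanSpace.proj (σ p.1.1)

/-- The functionals defining the chamber of type B in which the coordinates with signs `e` are
nonnegative and increasing in the order `σ`. -/
noncomputable def signedPermFunctional (e : Fin m → ℤˣ) (σ : Equiv.Perm (Fin m))
    (p : {p : Fin m × Fin m × ℤˣ // p.1 < p.2.1 ∨ p.1 = p.2.1 ∧ p.2.2 = -1}) :
    EuclideanSpace ℝ (Fin m) →L[ℝ] ℝ :=
  ((e (σ p.1.2.1) : ℤ) : ℝ) • EuclideanSpace.proj (σ p.1.2.1) -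
    ((p.1.2.2 : ℤ) : ℝ) • (((e (σ p.1.1) : ℤ) : ℝ) • EuclideanSpace.proj (σ p.1.1))

theorem permFunctional_apply (σ : Equiv.Perm (Fin m)) (p : {p : Fin m × Fin m // p.1 < p.2})
    (y : EuclideanSpace ℝ (Fin m)) :
    permFunctional σ p y = y (σ p.1.2) - y (σ p.1.1) := rfl

theorem signedPermFunctional_apply (e : Fin m → ℤˣ) (σ : Equiv.Perm (Fin m))
    (p : {p : Fin m × Fin m × ℤˣ // p.1 < p.2.1 ∨ p.1 = p.2.1 ∧ p.2.2 = -1})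
    (y : EuclideanSpace ℝ (Fin m)) :
    signedPermFunctional e σ p y = signedValues e y (σ p.1.2.1) -
      ((p.1.2.2 : ℤ) : ℝ) * signedValues e y (σ p.1.1) := rfl

theorem mem_polyhedralCone_permFunctional {σ : Equiv.Perm (Fin m)}
    {y : EuclideanSpace ℝ (Fin m)} : y ∈ polyhedralCone (permFunctional σ) ↔
      ∀ i j, i < j → y (σ i) ≤ y (σ j) :=
  ⟨fun h i j hij => sub_nonneg.1 (h ⟨(i, j), hij⟩), fun h p => sub_nonneg.2 (h _ _ p.2)⟩

/-- The functionals with `δ = -1` and `i < j` are redundant for the cone. They are included so that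
the zero sets of the functionals are all the mirrors; `i = j` gives twice a signed coordinate. -/
theorem mem_polyhedralCone_signedPermFunctional {e : Fin m → ℤˣ} {σ : Equiv.Perm (Fin m)}
    {y : EuclideanSpace ℝ (Fin m)} : y ∈ polyhedralCone (signedPermFunctional e σ) ↔
      (∀ i j, i < j → signedValues e y (σ i) ≤ signedValues e y (σ j)) ∧
        ∀ i, 0 ≤ signedValues e y i := by
  constructor
  · intro h
    refine ⟨fun i j hij => ?_, fun i => ?_⟩
    · have := h ⟨(i, j, 1), Or.inl hij⟩
      rw [signedPermFunctional_apply] at this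
      simpa using this
    · have := h ⟨(σ.symm i, σ.symm i, -1), Or.inr ⟨rfl, rfl⟩⟩
      rw [signedPermFunctional_apply] at this
      simp only [Equiv.apply_symm_apply, Units.val_neg, Units.val_one, Int.cast_neg,
        Int.cast_one] at this
      linarith
  · rintro ⟨h1, h2⟩ ⟨⟨i, j, δ⟩, h⟩
    rw [signedPermFunctional_apply]
    rcases Int.units_eq_one_or δ with rfl | rfl
    · have hij : i < j := h.resolve_right fun h => absurd h.2 (show (1 : ℤˣ) ≠ -1 by decide)
      simpa using h1 i j hij
    · have := h2 (σ i)
      have := h2 (σ j)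
      simp only [Units.val_neg, Units.val_one, Int.cast_neg, Int.cast_one]
      linarith

theorem exists_perm_of_isChamber {K : Set (EuclideanSpace ℝ (Fin m))}
    (hK : IsChamber (reflectionArrangement (permGroup m)) K) :
    ∃ σ, K = polyhedralCone (permFunctional σ) := by
  obtain ⟨p, hp, rfl⟩ := hK
  have hmem : ∀ y : EuclideanSpace ℝ (Fin m),
      y ∈ (⋃ H ∈ reflectionArrangement (permGroup m), (H : Set (EuclideanSpace ℝ (Fin m))))ᶜ ↔
        ∀ i j, i ≠ j → y i ≠ y j := by
    intro y
    simp only [Set.mem_compl_iff, Set.mem_iUnion, not_exists, SetLike.mem_coe]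
    constructor
    · intro h i j hij heq
      refine h _ (mem_reflectionArrangement_permGroup.2 ⟨i, j, hij, rfl⟩) ?_
      rw [mem_signedDiagonal, heq]
      simp
    · intro h H hH hy
      obtain ⟨i, j, hij, rfl⟩ := mem_reflectionArrangement_permGroup.1 hH
      refine h i j hij ?_
      rw [mem_signedDiagonal] at hy
      simpa using hy
  refine ⟨Tuple.sort p, closure_connectedComponentIn_eq_polyhedralCone (fun y => ?_) fun q => ?_⟩
  · rw [hmem]
    constructor
    · intro h q
      rw [permFunctional_apply, sub_ne_zero]
      exact h _ _ fun h => q.2.ne ((Tuple.sort p).injective h).symm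
    · intro h i j hij heq
      rcases lt_or_gt_of_ne ((Tuple.sort p).symm.injective.ne hij) with hlt | hlt
      · refine h ⟨(_, _), hlt⟩ ?_
        rw [permFunctional_apply]
        simp [heq]
      · refine h ⟨(_, _), hlt⟩ ?_
        rw [permFunctional_apply]
        simp [heq]
  · rw [permFunctional_apply, sub_pos]
    refine (Tuple.monotone_sort p q.2.le).lt_of_ne ?_
    exact (hmem p).1 hp _ _ fun h => q.2.ne ((Tuple.sort p).injective h)

theorem exists_signed_perm_of_isChamber {K : Set (EuclideanSpace ℝ (Fin m))}
    (hK : IsChamber (reflectionArrangement (groupB m)) K) :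
    ∃ e σ, K = polyhedralCone (signedPermFunctional e σ) := by
  obtain ⟨p, hp, rfl⟩ := hK
  have hmem : ∀ y : EuclideanSpace ℝ (Fin m),
      y ∈ (⋃ H ∈ reflectionArrangement (groupB m), (H : Set (EuclideanSpace ℝ (Fin m))))ᶜ ↔
        ∀ i j, ∀ δ : ℤˣ, (i ≠ j ∨ δ = -1) → y i ≠ ((δ : ℤ) : ℝ) * y j := by
    intro y
    simp only [Set.mem_compl_iff, Set.mem_iUnion, not_exists, SetLike.mem_coe]
    constructor
    · intro h i j δ hij heq
      exact h _ (mem_reflectionArrangement_groupB.2 ⟨i, j, δ, hij, rfl⟩)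
        (mem_signedDiagonal.2 heq)
    · intro h H hH hy
      obtain ⟨i, j, δ, hij, rfl⟩ := mem_reflectionArrangement_groupB.1 hH
      exact h i j δ hij (mem_signedDiagonal.1 hy)
  have hp' := (hmem p).1 hp
  have hp0 : ∀ i, p i ≠ 0 := by
    intro i hi
    exact hp' i i (-1) (Or.inr rfl) (by rw [hi, mul_zero])
  have hsign : ∀ i, ∃ ε : ℤˣ, ((ε : ℤ) : ℝ) * p i = |p i| := by
    intro i
    rcases (hp0 i).lt_or_gt with h | h
    · exact ⟨-1, by simp [abs_of_neg h]⟩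
    · exact ⟨1, by simp [abs_of_pos h]⟩
  choose e he using hsign
  set σ := Tuple.sort fun i => |p i| with hσ
  refine ⟨e, σ, closure_connectedComponentIn_eq_polyhedralCone (fun y => ?_) ?_⟩
  · have key : ∀ i j, ∀ δ : ℤˣ, signedValues e y j - ((δ : ℤ) : ℝ) * signedValues e y i = 0 ↔
        y j = (((e j * (δ * e i) : ℤˣ) : ℤ) : ℝ) * y i := by
      intro i j δ
      rw [sub_eq_zero, signedValues, signedValues, units_cast_mul_eq_iff]
      push_cast
      rw [mul_assoc, mul_assoc]
    rw [hmem]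
    constructor
    · rintro h ⟨⟨i, j, δ⟩, hq⟩
      rw [signedPermFunctional_apply, Ne, key]
      refine h _ _ _ ?_
      rcases hq with hq | ⟨hq, hδ⟩
      · exact Or.inl fun h => hq.ne (σ.injective h).symm
      · right
        dsimp only at hq hδ ⊢
        subst hq hδ
        rw [mul_comm, mul_assoc, Int.units_mul_self, mul_one]
    · intro h i j δ hij heq
      -- The sign of the functional is that of the mirror multiplied by the signs of its two
      -- letters; this undoes the twist.
      have hone : ∀ a b : Fin m, ∀ η : ℤˣ, e a * (e a * η * e b * e b) = η := by
        intro a b η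
        rw [mul_assoc (e a * η), Int.units_mul_self, mul_one, ← mul_assoc, Int.units_mul_self,
          one_mul]
      rcases lt_trichotomy (σ.symm i) (σ.symm j) with hlt | heq' | hlt
      · refine h ⟨(σ.symm i, σ.symm j, e j * δ * e i), Or.inl hlt⟩ ?_
        rw [signedPermFunctional_apply, key]
        simp only [Equiv.apply_symm_apply]
        rw [hone, eq_comm, units_cast_mul_eq_iff, heq]
      · have hij' := σ.symm.injective heq'
        subst hij'
        have hδ := hij.resolve_left (not_not.2 rfl)
        refine h ⟨(σ.symm i, σ.symm i, -1), Or.inr ⟨rfl, rfl⟩⟩ ?_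
        rw [signedPermFunctional_apply, key]
        simp only [Equiv.apply_symm_apply]
        rw [mul_comm (-1), ← mul_assoc, Int.units_mul_self, one_mul, ← hδ]
        exact heq
      · refine h ⟨(σ.symm j, σ.symm i, e i * δ * e j), Or.inl hlt⟩ ?_
        rw [signedPermFunctional_apply, key]
        simp only [Equiv.apply_symm_apply]
        rw [hone]
        exact heq
  · rintro ⟨⟨i, j, δ⟩, hq⟩
    rw [signedPermFunctional_apply]
    simp only [signedValues, he]
    have hi : 0 < |p (σ i)| := abs_pos.2 (hp0 _)
    have hj : 0 < |p (σ j)| := abs_pos.2 (hp0 _)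
    rcases Int.units_eq_one_or δ with rfl | rfl
    · have hij : i < j := hq.resolve_right fun h => absurd h.2 (show (1 : ℤˣ) ≠ -1 by decide)
      have h1 : |p (σ i)| ≤ |p (σ j)| := Tuple.monotone_sort (fun i => |p i|) hij.le
      have h2 : |p (σ i)| ≠ |p (σ j)| := by
        intro h
        have hne : σ i ≠ σ j := fun h => hij.ne (σ.injective h)
        rcases abs_eq_abs.1 h with h | h
        · exact hp' _ _ 1 (Or.inl hne) (by simpa using h)
        · exact hp' _ _ (-1) (Or.inl hne) (by simpa using h)
      simpa using h1.lt_of_ne h2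
    · simp only [Units.val_neg, Units.val_one, Int.cast_neg, Int.cast_one]
      linarith

/-- The dimension of the space of vectors that are constant up to the signs `e` on the level sets
of `c`, and zero on those with value in `Z`. -/
theorem finrank_eq_card_image_sdiff {X : Submodule ℝ (EuclideanSpace ℝ (Fin m))}
    {c : Fin m → ℝ} {e : Fin m → ℤˣ} {Z : Finset ℝ}
    (hX : ∀ y : EuclideanSpace ℝ (Fin m), y ∈ X ↔
      (∀ i j, c i = c j → signedValues e y i = signedValues e y j) ∧ ∀ i, c i ∈ Z → y i = 0) :
    Module.finrank ℝ X = (Finset.univ.image c \ Z).card := by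
  classical
  rcases isEmpty_or_nonempty (Fin m) with _ | _
  · rw [Module.finrank_zero_of_subsingleton]
    simp
  have hrep : ∀ a ∈ Finset.univ.image c \ Z, ∃ i, c i = a := by
    intro a ha
    simpa using (Finset.mem_sdiff.1 ha).1
  -- One representative index for each level set outside `Z`; these are the free coordinates.
  choose! r hr using hrep
  have hcmem : ∀ i, c i ∉ Z → c i ∈ Finset.univ.image c \ Z := fun i hi =>
    Finset.mem_sdiff.2 ⟨Finset.mem_image_of_mem c (Finset.mem_univ i), hi⟩
  have hJ : IsCoordinateBasis X ((Finset.univ.image c \ Z).image r) := by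
    refine ⟨fun i => ?_, fun y => ?_⟩
    · by_cases hi : c i ∈ Z
      · exact Or.inl fun x hx => ((hX x).1 hx).2 i hi
      · refine Or.inr ⟨r (c i), Finset.mem_image_of_mem r (hcmem i hi), e i * e (r (c i)),
          fun x hx => ?_⟩
        have := ((hX x).1 hx).1 i (r (c i)) (hr _ (hcmem i hi)).symm
        rw [signedValues, signedValues, units_cast_mul_eq_iff] at this
        rw [this]
        push_cast
        ring
    · refine ⟨WithLp.toLp 2 fun i => if c i ∈ Z then 0 else
        ((e i : ℤ) : ℝ) * (((e (r (c i)) : ℤ) : ℝ) * y (r (c i))), (hX _).2 ⟨?_, ?_⟩, ?_⟩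
      · intro i j hij
        simp only [signedValues, hij]
        split_ifs
        · simp
        · rw [← mul_assoc, units_cast_mul_self, ← mul_assoc ((e j : ℤ) : ℝ), units_cast_mul_self]
      · intro i hi
        simp [hi]
      · intro j hj
        obtain ⟨a, ha, rfl⟩ := Finset.mem_image.1 hj
        simp only
        rw [hr a ha, if_neg (Finset.mem_sdiff.1 ha).2, ← mul_assoc, units_cast_mul_self, one_mul]
  rw [hJ.finrank_eq, Finset.card_image_of_injOn]
  intro a ha b hb hab
  rw [← hr a ha, hab, hr b hb]

theorem isKDimensional_permFunctional_iff {σ : Equiv.Perm (Fin m)}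
    {z : EuclideanSpace ℝ (Fin m)} (hz : z ∈ polyhedralCone (permFunctional σ)) (k : ℕ) :
    IsKDimensional (polyhedralCone (permFunctional σ)) z k ↔ (Finset.univ.image z).card = k := by
  rw [isKDimensional_polyhedralCone_iff, and_iff_right hz,
    finrank_eq_card_image_sdiff (c := z) (e := 1) (Z := ∅), Finset.sdiff_empty]
  intro y
  simp only [Finset.notMem_empty, false_imp_iff, implies_true, and_true, signedValues,
    Pi.one_apply, Units.val_one, Int.cast_one, one_mul]
  rw [mem_activeSpace]
  constructor
  · intro h
    have key : ∀ i j, i < j → z (σ i) = z (σ j) → y (σ i) = y (σ j) := by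
      intro i j hij hz
      have := h ⟨(i, j), hij⟩ (by rw [permFunctional_apply, hz, sub_self])
      rw [permFunctional_apply] at this
      linarith
    intro i j hij
    rcases lt_trichotomy (σ.symm i) (σ.symm j) with hlt | heq | hlt
    · simpa using key _ _ hlt (by simpa using hij)
    · rw [σ.symm.injective heq]
    · simpa using (key _ _ hlt (by simpa using hij.symm)).symm
  · intro h p hp
    rw [permFunctional_apply, sub_eq_zero] at hp ⊢
    exact h _ _ hp

theorem isKDimensional_signedPermFunctional_iff {e : Fin m → ℤˣ} {σ : Equiv.Perm (Fin m)}
    {z : EuclideanSpace ℝ (Fin m)} (hz : z ∈ polyhedralCone (signedPermFunctional e σ)) (k : ℕ) :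
    IsKDimensional (polyhedralCone (signedPermFunctional e σ)) z k ↔
      ((Finset.univ.image (signedValues e z)).erase 0).card = k := by
  rw [isKDimensional_polyhedralCone_iff, and_iff_right hz,
    finrank_eq_card_image_sdiff (c := signedValues e z) (e := e) (Z := {0}),
    Finset.sdiff_singleton_eq_erase]
  intro y
  have hnn := (mem_polyhedralCone_signedPermFunctional.1 hz).2
  have hy0 : ∀ i, signedValues e y i = 0 ↔ y i = 0 := fun i => by
    rw [signedValues, mul_eq_zero, or_iff_right (units_cast_ne_zero _)]
  rw [mem_activeSpace]
  simp only [Finset.mem_singleton]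
  constructor
  · intro h
    have key : ∀ i j, i < j → signedValues e z (σ i) = signedValues e z (σ j) →
        signedValues e y (σ i) = signedValues e y (σ j) := by
      intro i j hij hz
      have := h ⟨(i, j, 1), Or.inl hij⟩ (by rw [signedPermFunctional_apply, hz]; simp)
      rw [signedPermFunctional_apply] at this
      simp only [Units.val_one, Int.cast_one, one_mul] at this
      linarith
    refine ⟨fun i j hij => ?_, fun i hi => ?_⟩
    · rcases lt_trichotomy (σ.symm i) (σ.symm j) with hlt | heq | hlt
      · simpa using key _ _ hlt (by simpa using hij)
      · rw [σ.symm.injective heq]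
      · simpa using (key _ _ hlt (by simpa using hij.symm)).symm
    · have := h ⟨(σ.symm i, σ.symm i, -1), Or.inr ⟨rfl, rfl⟩⟩
        (by rw [signedPermFunctional_apply]; simp [hi])
      rw [signedPermFunctional_apply] at this
      simp only [Equiv.apply_symm_apply, Units.val_neg, Units.val_one, Int.cast_neg,
        Int.cast_one] at this
      rw [← hy0]
      linarith
  · rintro ⟨h1, h2⟩ ⟨⟨i, j, δ⟩, hq⟩ hp
    rw [signedPermFunctional_apply] at hp ⊢
    rcases Int.units_eq_one_or δ with rfl | rfl
    · simp only [Units.val_one, Int.cast_one, one_mul] at hp ⊢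
      rw [h1 _ _ (sub_eq_zero.1 hp), sub_self]
    · simp only [Units.val_neg, Units.val_one, Int.cast_neg, Int.cast_one, neg_mul, one_mul,
        sub_neg_eq_add] at hp ⊢
      have hi := hnn (σ i)
      have hj := hnn (σ j)
      rw [(hy0 _).2 (h2 _ (by linarith)), (hy0 _).2 (h2 _ (by linarith)), add_zero]

end Chambers

/-! ### Counting the projections -/

section Projections

variable {m : ℕ}

theorem weightAct_signedPerm {ω : Fin m → ℝ} (hω : ∀ i, 0 < ω i) (t : Fin m → ℤˣ)
    (τ : Equiv.Perm (Fin m)) (i : Fin m) : weightAct (signedPerm t τ) ω i = ω (τ i) := by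
  rw [weightAct, signedPerm_apply, abs_mul, abs_units_cast, one_mul]
  exact abs_of_pos (hω _)

/-- Carry a vector back along the permutation `τ`, with signs `e`. -/
noncomputable def pullBack (e : Fin m → ℤˣ) (τ : Equiv.Perm (Fin m))
    (z : EuclideanSpace ℝ (Fin m)) : Fin m → ℝ := fun j => signedValues e z (τ.symm j)

theorem pullBack_surjective (e : Fin m → ℤˣ) (τ : Equiv.Perm (Fin m)) :
    Function.Surjective (pullBack e τ) := by
  intro u
  refine ⟨WithLp.toLp 2 fun i => ((e i : ℤ) : ℝ) * u (τ i), funext fun j => ?_⟩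
  simp only [pullBack, signedValues]
  rw [← mul_assoc, units_cast_mul_self, one_mul, Equiv.apply_symm_apply]

theorem image_pullBack (e : Fin m → ℤˣ) (τ : Equiv.Perm (Fin m))
    (z : EuclideanSpace ℝ (Fin m)) :
    Finset.univ.image (pullBack e τ z) = Finset.univ.image (signedValues e z) := by
  ext a
  simp only [Finset.mem_image, Finset.mem_univ, true_and, pullBack]
  exact (τ.symm.surjective.exists (p := fun i => signedValues e z i = a)).symm

/-- The sign of a letter in terms of the signs of the chamber and of a signed permutation. -/
def letterSigns (e t : Fin m → ℤˣ) (τ : Equiv.Perm (Fin m)) : Fin m → ℤˣ :=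
  fun j => e (τ.symm j) * t (τ.symm j)

/-- Because the weights travel with the coordinates, reindexing by `τ` restores the same `ω` for
every group element. The chamber signs are absorbed into the data, which does not alter the squares.
-/
theorem isWeightedProjection_signedPerm_iff {K : Set (EuclideanSpace ℝ (Fin m))}
    {e : Fin m → ℤˣ} {τ : Equiv.Perm (Fin m)} {L : Set (Fin m → ℝ)}
    (hK : ∀ y, y ∈ K ↔ pullBack e τ y ∈ L) {ω : Fin m → ℝ} (hω : ∀ i, 0 < ω i)
    (t : Fin m → ℤˣ) (x z : EuclideanSpace ℝ (Fin m)) :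
    IsWeightedProjection K (signedPerm t τ x) (weightAct (signedPerm t τ) ω) z ↔
      pullBack e τ z ∈ L ∧ ∀ u ∈ L,
        ∑ i, ω i * (pullBack e τ z i - signedValues (letterSigns e t τ) x i) ^ 2 ≤
          ∑ i, ω i * (u i - signedValues (letterSigns e t τ) x i) ^ 2 := by
  have key : ∀ y : EuclideanSpace ℝ (Fin m),
      ∑ i, weightAct (signedPerm t τ) ω i * (y i - signedPerm t τ x i) ^ 2 =
      ∑ i, ω i * (pullBack e τ y i - signedValues (letterSigns e t τ) x i) ^ 2 := by
    intro y
    rw [← Equiv.sum_comp τ fun i =>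
      ω i * (pullBack e τ y i - signedValues (letterSigns e t τ) x i) ^ 2]
    refine Finset.sum_congr rfl fun i _ => ?_
    rw [weightAct_signedPerm hω, signedPerm_apply]
    simp only [pullBack, signedValues, letterSigns, Equiv.symm_apply_apply]
    push_cast
    linear_combination (-(ω (τ i)) * (y i - ((t i : ℤ) : ℝ) * x (τ i)) ^ 2) *
      units_cast_mul_self (e i)
  rw [IsWeightedProjection, hK, isMinOn_iff]
  refine and_congr_right fun _ => ?_
  simp only [key]
  constructor
  · intro h u hu
    obtain ⟨y, rfl⟩ := pullBack_surjective e τ u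
    exact h y ((hK y).2 hu)
  · intro h y hy
    exact h _ ((hK y).1 hy)

theorem pairwise_ofFn_mul_iff {R : Fin m → Fin m → Prop} {τ σ : Equiv.Perm (Fin m)} :
    (List.ofFn (τ * σ)).Pairwise R ↔ ∀ i j, i < j → R (τ (σ i)) (τ (σ j)) :=
  List.pairwise_ofFn

theorem exists_isKDimensional_permFunctional_iff {ω : Fin m → ℝ} (hω : ∀ i, 0 < ω i)
    (σ τ : Equiv.Perm (Fin m)) (x : EuclideanSpace ℝ (Fin m)) (k : ℕ) :
    (∃ z, IsWeightedProjection (polyhedralCone (permFunctional σ)) (signedPerm 1 τ x)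
        (weightAct (signedPerm 1 τ) ω) z ∧
        IsKDimensional (polyhedralCone (permFunctional σ)) z k) ↔
      (blocks hω (x : Fin m → ℝ) (List.ofFn (τ * σ))).length = k := by
  have hsv : ∀ y : EuclideanSpace ℝ (Fin m), signedValues 1 y = y := fun y => by
    funext i
    simp [signedValues]
  have hK : ∀ y, y ∈ polyhedralCone (permFunctional σ) ↔
      pullBack 1 τ y ∈ {u : Fin m → ℝ | (List.ofFn (τ * σ)).Pairwise fun i j => u i ≤ u j} := by
    intro y
    rw [mem_polyhedralCone_permFunctional, Set.mem_ofPred_eq, pairwise_ofFn_mul_iff]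
    simp [pullBack, hsv]
  have hx : signedValues (letterSigns 1 1 τ) x = x := by
    rw [← hsv x]
    funext i
    simp [letterSigns, signedValues]
  have hproj : ∀ z, IsWeightedProjection (polyhedralCone (permFunctional σ)) (signedPerm 1 τ x)
      (weightAct (signedPerm 1 τ) ω) z ↔
      pullBack 1 τ z = blockMean hω (x : Fin m → ℝ) (List.ofFn (τ * σ)) := by
    intro z
    rw [isWeightedProjection_signedPerm_iff hK hω, hx]
    exact isotonic_iff hω (nodup_ofFn_perm _) (mem_ofFn_perm _) _
  have hdim : ∀ z, pullBack 1 τ z = blockMean hω (x : Fin m → ℝ) (List.ofFn (τ * σ)) →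
      (Finset.univ.image z).card = (blocks hω (x : Fin m → ℝ) (List.ofFn (τ * σ))).length := by
    intro z hz
    rw [← card_image_blockMean hω (nodup_ofFn_perm _) (mem_ofFn_perm _), ← hz, image_pullBack, hsv]
  constructor
  · rintro ⟨z, hz, hk⟩
    rw [isKDimensional_permFunctional_iff hz.1] at hk
    rw [← hk, hdim z ((hproj z).1 hz)]
  · intro hk
    obtain ⟨z, hz⟩ := pullBack_surjective 1 τ (blockMean hω (x : Fin m → ℝ) (List.ofFn (τ * σ)))
    have hz' := (hproj z).2 hz
    exact ⟨z, hz', (isKDimensional_permFunctional_iff hz'.1 k).2 (by rw [hdim z hz, hk])⟩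

theorem exists_isKDimensional_signedPermFunctional_iff {ω : Fin m → ℝ} (hω : ∀ i, 0 < ω i)
    (e t : Fin m → ℤˣ) (σ τ : Equiv.Perm (Fin m)) (x : EuclideanSpace ℝ (Fin m)) (k : ℕ) :
    (∃ z, IsWeightedProjection (polyhedralCone (signedPermFunctional e σ)) (signedPerm t τ x)
        (weightAct (signedPerm t τ) ω) z ∧
        IsKDimensional (polyhedralCone (signedPermFunctional e σ)) z k) ↔
      ((blocks hω (signedValues (letterSigns e t τ) x) (List.ofFn (τ * σ))).countP fun b =>
        0 < listMean ω (signedValues (letterSigns e t τ) x) b) = k := by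
  set x' := signedValues (letterSigns e t τ) x with hx'
  have hK : ∀ y, y ∈ polyhedralCone (signedPermFunctional e σ) ↔
      pullBack e τ y ∈ {u : Fin m → ℝ | ((List.ofFn (τ * σ)).Pairwise fun i j => u i ≤ u j) ∧
        ∀ i, 0 ≤ u i} := by
    intro y
    rw [mem_polyhedralCone_signedPermFunctional, Set.mem_ofPred_eq, pairwise_ofFn_mul_iff]
    refine and_congr (by simp [pullBack]) ?_
    exact τ.symm.surjective.forall
  have hproj : ∀ z, IsWeightedProjection (polyhedralCone (signedPermFunctional e σ))
      (signedPerm t τ x) (weightAct (signedPerm t τ) ω) z ↔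
      pullBack e τ z = fun i => max (blockMean hω x' (List.ofFn (τ * σ)) i) 0 := by
    intro z
    rw [isWeightedProjection_signedPerm_iff hK hω]
    exact nonneg_isotonic_iff hω (nodup_ofFn_perm _) (mem_ofFn_perm _) _
  have hdim : ∀ z, (pullBack e τ z = fun i => max (blockMean hω x' (List.ofFn (τ * σ)) i) 0) →
      ((Finset.univ.image (signedValues e z)).erase 0).card =
        (blocks hω x' (List.ofFn (τ * σ))).countP fun b => 0 < listMean ω x' b := by
    intro z hz
    rw [← card_image_max_blockMean hω (nodup_ofFn_perm _) (mem_ofFn_perm _), ← hz, image_pullBack]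
  constructor
  · rintro ⟨z, hz, hk⟩
    rw [isKDimensional_signedPermFunctional_iff hz.1] at hk
    rw [← hk, hdim z ((hproj z).1 hz)]
  · intro hk
    obtain ⟨z, hz⟩ := pullBack_surjective e τ
      fun i => max (blockMean hω x' (List.ofFn (τ * σ)) i) 0
    have hz' := (hproj z).2 hz
    exact ⟨z, hz', (isKDimensional_signedPermFunctional_iff hz'.1 k).2 (by rw [hdim z hz, hk])⟩

theorem projectionCount_permGroup {K : Set (EuclideanSpace ℝ (Fin m))}
    (hK : IsChamber (reflectionArrangement (permGroup m)) K) {ω : Fin m → ℝ}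
    (hω : ∀ i, 0 < ω i) {x : EuclideanSpace ℝ (Fin m)} (hx : IsGenericValues ω x) (k : ℕ) :
    (projectionCount (permGroup m) K ω x k : ℤ) =
      |(charPoly (reflectionArrangement (permGroup m))).coeff k| := by
  obtain ⟨σ, rfl⟩ := exists_perm_of_isChamber hK
  rw [charPoly_permGroup, ← card_perm_blocks hω hx, Nat.cast_inj]
  have h1 : {g | g ∈ permGroup m ∧ ∃ z, IsWeightedProjection (polyhedralCone (permFunctional σ))
      (g x) (weightAct g ω) z ∧ IsKDimensional (polyhedralCone (permFunctional σ)) z k} =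
      -- The element with permutation `τ` orders the letters by `τ * σ`, hence the shift by `σ⁻¹`.
      (fun τ => signedPerm 1 (τ * σ⁻¹)) '' (({τ : Equiv.Perm (Fin m) |
        (blocks hω (x : Fin m → ℝ) (List.ofFn τ)).length = k} : Finset _) : Set _) := by
    ext g
    simp only [Set.mem_ofPred_eq, Set.mem_image, Finset.coe_filter, Finset.mem_univ, true_and]
    constructor
    · rintro ⟨hg, h⟩
      obtain ⟨τ, rfl⟩ := mem_permGroup.1 hg
      exact ⟨τ * σ, (exists_isKDimensional_permFunctional_iff hω σ τ x k).1 h, by simp⟩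
    · rintro ⟨τ, h, rfl⟩
      refine ⟨mem_permGroup.2 ⟨_, rfl⟩, ?_⟩
      rw [exists_isKDimensional_permFunctional_iff hω, inv_mul_cancel_right]
      exact h
  rw [projectionCount, h1, Set.ncard_image_of_injective, Set.ncard_coe_finset]
  exact fun τ τ' h => mul_right_cancel (signedPerm_injective h).2

theorem projectionCount_groupB {K : Set (EuclideanSpace ℝ (Fin m))}
    (hK : IsChamber (reflectionArrangement (groupB m)) K) {ω : Fin m → ℝ}
    (hω : ∀ i, 0 < ω i) {x : EuclideanSpace ℝ (Fin m)}
    (hx : ∀ e, IsGenericValues ω (signedValues e x))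
    (hx' : ∀ e : Fin m → ℤˣ, ∀ B : Finset (Fin m), B.Nonempty →
      ∑ i ∈ B, ω i * signedValues e x i ≠ 0) (k : ℕ) :
    (projectionCount (groupB m) K ω x k : ℤ) =
      |(charPoly (reflectionArrangement (groupB m))).coeff k| := by
  obtain ⟨e, σ, rfl⟩ := exists_signed_perm_of_isChamber hK
  rw [charPoly_groupB, ← card_signed_perm_blocks hω hx hx', Nat.cast_inj]
  let f : (Fin m → ℤˣ) × Equiv.Perm (Fin m) →
      (EuclideanSpace ℝ (Fin m) ≃ₗᵢ[ℝ] EuclideanSpace ℝ (Fin m)) :=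
    -- The signs are chosen so that the letters end up with signs `p.1` and are listed in the order
    -- `p.2`.
    fun p => signedPerm (fun i => e i * p.1 ((p.2 * σ⁻¹) i)) (p.2 * σ⁻¹)
  have hsigns : ∀ p : (Fin m → ℤˣ) × Equiv.Perm (Fin m),
      letterSigns e (fun i => e i * p.1 ((p.2 * σ⁻¹) i)) (p.2 * σ⁻¹) = p.1 := by
    intro p
    funext j
    rw [letterSigns, ← mul_assoc, Int.units_mul_self, one_mul, Equiv.apply_symm_apply]
  have hf : Function.Injective f := by
    intro p q hpq
    obtain ⟨h1, h2⟩ := signedPerm_injective hpq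
    refine Prod.ext ?_ (mul_right_cancel h2)
    rw [← hsigns p, ← hsigns q, h1, h2]
  have h1 : {g | g ∈ groupB m ∧ ∃ z, IsWeightedProjection
      (polyhedralCone (signedPermFunctional e σ)) (g x) (weightAct g ω) z ∧
      IsKDimensional (polyhedralCone (signedPermFunctional e σ)) z k} =
      f '' (({p : (Fin m → ℤˣ) × Equiv.Perm (Fin m) |
        ((blocks hω (signedValues p.1 x) (List.ofFn p.2)).countP fun b =>
          0 < listMean ω (signedValues p.1 x) b) = k} : Finset _) : Set _) := by
    ext g
    simp only [Set.mem_ofPred_eq, Set.mem_image, Finset.coe_filter, Finset.mem_univ, true_and]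
    constructor
    · rintro ⟨hg, h⟩
      obtain ⟨t, τ, rfl⟩ := mem_groupB.1 hg
      refine ⟨(letterSigns e t τ, τ * σ),
        (exists_isKDimensional_signedPermFunctional_iff hω e t σ τ x k).1 h, ?_⟩
      simp only [f, mul_inv_cancel_right]
      congr 1
      funext i
      rw [letterSigns, Equiv.symm_apply_apply, ← mul_assoc, Int.units_mul_self, one_mul]
    · rintro ⟨p, h, rfl⟩
      refine ⟨mem_groupB.2 ⟨_, _, rfl⟩, ?_⟩
      rw [exists_isKDimensional_signedPermFunctional_iff hω, hsigns, inv_mul_cancel_right]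
      exact h
  rw [projectionCount, h1, Set.ncard_image_of_injective _ hf, Set.ncard_coe_finset]

end Projections

end ReflArr

theorem theorem3p3 (n : ℕ) :
    (ReflArr.charPoly (ReflArr.reflectionArrangement (ReflArr.groupA n)) =
        ∏ j ∈ Finset.range (n + 1), (X - C (j : ℤ)) ∧
      ∀ (K : Set (EuclideanSpace ℝ (Fin (n + 1)))) (ω : Fin (n + 1) → ℝ),
        ReflArr.IsChamber (ReflArr.reflectionArrangement (ReflArr.groupA n)) K →
        (∀ i, 0 < ω i) →
        ReflArr.ForGeneric K fun x => ∀ k : ℕ,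
          (ReflArr.projectionCount (ReflArr.groupA n) K ω x k : ℤ) =
            |(ReflArr.charPoly (ReflArr.reflectionArrangement (ReflArr.groupA n))).coeff k|) ∧
    (ReflArr.charPoly (ReflArr.reflectionArrangement (ReflArr.groupB n)) =
        ∏ j ∈ Finset.range n, (X - C (2 * (j : ℤ) + 1)) ∧
      ∀ (K : Set (EuclideanSpace ℝ (Fin n))) (ω : Fin n → ℝ),
        ReflArr.IsChamber (ReflArr.reflectionArrangement (ReflArr.groupB n)) K →
        (∀ i, 0 < ω i) →
        ReflArr.ForGeneric K fun x => ∀ k : ℕ,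
          (ReflArr.projectionCount (ReflArr.groupB n) K ω x k : ℤ) =
            |(ReflArr.charPoly (ReflArr.reflectionArrangement (ReflArr.groupB n))).coeff k|) := by
  refine ⟨⟨ReflArr.charPoly_permGroup (n + 1), fun K ω hK hω => ?_⟩,
    ReflArr.charPoly_groupB n, fun K ω hK hω => ?_⟩
  · refine (ReflArr.forGeneric_isGenericValues K hω).mono fun x hx k => ?_
    have h : ReflArr.IsGenericValues ω x := by
      convert hx.1 1 using 1
      funext i
      simp [ReflArr.signedValues]
    exact ReflArr.projectionCount_permGroup hK hω h k
  · exact (ReflArr.forGeneric_isGenericValues K hω).mono fun x hx k =>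
      ReflArr.projectionCount_groupB hK hω hx.1 hx.2 k
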